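/- Let $d\ge 3$ and $p\ge 1$. There are constants $M,C>0$, depending only on $d$ and $p$, with the following property. Let $\mu$ and $\lambda$ be independent Poisson point processes on $\mathbb{R}^d$ with intensity one. Let $R=x+\prod_{i=1}^d[0,L_i]$ (all $L_i>0$) be a rectangle of moderate aspect ratio, i.e. $L_i/L_j\le 2$ for all $i,j$, with Lebesgue measure $|R|\ge M$. Let $\{R_i\}$ be an admissible partition of $R$, i.e. a finite family of rectangles $R_i$ of moderate aspect ratio with union $R$, pairwise disjoint up to Lebesgue-null sets, with $3^{-d}|R|\le |R_i|\le |R|$ for every $i$. Set $\kappa_i=\mu(R_i)/\lambda(R_i)$ and $\kappa=\mu(R)/\lambda(R)$; these are defined on the event $E=\{\lambda(R_i)>0 \text{ for all } i\}$. Then $$\mathbb{E}\Big[\mathbf 1_E\,\frac1{|R|}\,W^p_R\Big(\sum_i\kappa_i\chi_{R_i}\lambda,\ \kappa\lambda\Big)\Big]\le C\,|R|^{-\frac{d-2}{2d}}.$$ Here $W^p_R(\alpha,\beta)=\min_\pi\int|x-y|^p\,d\pi(x,y)$, the minimum being over all couplings $\pi$ (measures on $\mathbb{R}^d\times\mathbb{R}^d$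 with marginals $\alpha|_R$ and $\beta|_R$), and $\chi_{R_i}\lambda$ is the restriction of $\lambda$ to $R_i$. -/

import Mathlib

open MeasureTheory ProbabilityTheory Set
open scoped NNReal ENNReal

/-- The closed rectangle `x + ∏ i, [0, L i]` in `ℝ^d`. -/
def rectangle {d : ℕ} (x : EuclideanSpace ℝ (Fin d)) (L : Fin d → ℝ) :
    Set (EuclideanSpace ℝ (Fin d)) :=
  {y | ∀ i, x i ≤ y i ∧ y i ≤ x i + L i}

/-- `R` is a (nondegenerate) rectangle of moderate aspect ratio:
any two of its side lengths have ratio at most `2`. -/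
def IsModerateRectangle {d : ℕ} (R : Set (EuclideanSpace ℝ (Fin d))) : Prop :=
  ∃ (x : EuclideanSpace ℝ (Fin d)) (L : Fin d → ℝ),
    (∀ i, 0 < L i) ∧ (∀ i j, L i / L j ≤ 2) ∧ R = rectangle x L

/-- `R₁, …, R_N` is an admissible partition of `R`: the `R_i` are closed rectangles of moderate
aspect ratio that cover `R` and overlap only in Lebesgue-null sets, with
`3^{-d} |R| ≤ |R_i| ≤ |R|`. -/
structure IsAdmissiblePartition {d N : ℕ} (R : Set (EuclideanSpace ℝ (Fin d)))
    (Ri : Fin N → Set (EuclideanSpace ℝ (Fin d))) : Prop where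
  iUnion_eq : ⋃ i, Ri i = R
  null_inter : ∀ i j, i ≠ j → volume (Ri i ∩ Ri j) = 0
  moderate : ∀ i, IsModerateRectangle (Ri i)
  le_volume : ∀ i, ((3 : ℝ) ^ d)⁻¹ * volume.real R ≤ volume.real (Ri i)
  volume_le : ∀ i, volume.real (Ri i) ≤ volume.real R

/-- A Poisson point process on `ℝ^d` with intensity one: a random variable with values in the
locally finite measures of the form `∑ i, δ_{X i}`, whose values on disjoint Borel sets are
independent, and whose value on `A` has the Poisson law of parameter `|A|`. -/
structure IsPoissonProcess {d : ℕ} {Ω : Type*} [MeasurableSpace Ω] (P : Measure Ω)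
    (μ : Ω → Measure (EuclideanSpace ℝ (Fin d))) : Prop where
  measurable : Measurable μ
  atomic : ∀ ω, ∃ (ι : Type) (_ : Countable ι) (X : ι → EuclideanSpace ℝ (Fin d)),
    μ ω = Measure.sum fun i => Measure.dirac (X i)
  locallyFinite : ∀ ω, IsLocallyFiniteMeasure (μ ω)
  indep : ∀ (k : ℕ) (A : Fin k → Set (EuclideanSpace ℝ (Fin d))),
    (∀ i, MeasurableSet (A i)) → Pairwise (fun i j => Disjoint (A i) (A j)) →
      iIndepFun (fun i ω => μ ω (A i)) P
  law : ∀ A : Set (EuclideanSpace ℝ (Fin d)), MeasurableSet A → volume A ≠ ∞ →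
    HasLaw (fun ω => μ ω A)
      ((poissonMeasure (volume A).toNNReal).map fun n : ℕ => (n : ℝ≥0∞)) P

/-- The `p`-th power `W_p^p(μ, ν)` of the Wasserstein distance of order `p`: the infimum of
`∫ |x - y|^p dπ` over all couplings `π` of `μ` and `ν`. It is `∞` when the masses differ, as there
is no coupling then, and `0` for two zero measures. -/
noncomputable def transportCost {d : ℕ} (p : ℝ) (μ ν : Measure (EuclideanSpace ℝ (Fin d))) :
    ℝ≥0∞ :=
  ⨅ (π : Measure (EuclideanSpace ℝ (Fin d) × EuclideanSpace ℝ (Fin d)))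
    (_ : π.map Prod.fst = μ ∧ π.map Prod.snd = ν), ∫⁻ z, edist z.1 z.2 ^ p ∂π

/-- `W^p_R(μ, ν)`: the transportation cost between the restrictions of `μ` and `ν` to `R`. -/
noncomputable def transportCostOn {d : ℕ} (p : ℝ) (R : Set (EuclideanSpace ℝ (Fin d)))
    (μ ν : Measure (EuclideanSpace ℝ (Fin d))) : ℝ≥0∞ :=
  transportCost p (μ.restrict R) (ν.restrict R)

/-- The ratio of masses `μ(A) / λ(A)`, meaningful when `λ(A) > 0`. -/
noncomputable def massRatio {d : ℕ} (μ lam : Measure (EuclideanSpace ℝ (Fin d)))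
    (A : Set (EuclideanSpace ℝ (Fin d))) : ℝ≥0∞ :=
  μ A / lam A

/-! Cut `R` into `n ^ d` cells with sides between 1 and 8, so that `n` is of order `|R| ^ (1 / d)`.
Point counts in `R` and in the pieces fluctuate by the square root of the volume, so the ratios
`κ_i` and `κ` differ by a quantity `η` of order `n ^ (-d / 2)`: source `α` and target `β` differ
from each other by at most a multiple of order `η` of `λ`.

To remove this difference, a surplus `E` and a deficit `E'` of equal mass are both spread uniformly
over all cells: from every cell to every cell along a discrete segment, in `n` hops between
neighbouring cells. Both flows end in the same measure, so the first followed by the reverse of the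
second carries `E` to `E'` (`transportCost_le_of_grid`). The hops are performed simultaneously, as
in a bucket chain, by mass already present at the points of `λ`; by
`transportCost_le_of_partial_plan` it is enough that the total outgoing mass stays below `α`. The
segments do not crowd (`card_gridPath_eq_le`), so each hop moves a multiple of `λ` of order `η` up
to powers of a slowly growing `T`, and the sum over `n` hops is below `λ / 2` because `n ^ (1 - d /
2)` tends to zero for `d ≥ 3`. A hop has length of order one, so for every `p` the cost per unit
volume is of order `η * n`, that is `n ^ (1 - d / 2)`, the order of `|R| ^ (-(d - 2) / (2 d))`.

Since `λ` is discrete, a hop joins blocks of cells reaching out to the nearest nonempty cell instead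
of single cells; the block radii have exponential tails. The cost is then a sum of products of a
normalized deviation, a cell count and a power of a radius. Each product is dominated by a sum of
exponentials (`mul_count_mul_rpow_le`) whose expectations are bounded separately. If one of these
quantities exceeds `T = ⌈n ^ ε⌉`, the crude bound by diameter and mass is used; it gains a factor
`exp (-T / 4)` which beats every power of `n` (`measure_le_totalWeight`). -/

/-! ### Moments, void probabilities and null sets of a Poisson process. -/

namespace IsPoissonProcess

variable {d : ℕ} {Ω : Type*} [MeasurableSpace Ω] {P : Measure Ω}
  {μ : Ω → Measure (EuclideanSpace ℝ (Fin d))} {A : Set (EuclideanSpace ℝ (Fin d))}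

theorem measurable_apply (hμ : IsPoissonProcess P μ) (hA : MeasurableSet A) :
    Measurable fun ω => μ ω A :=
  (Measure.measurable_coe hA).comp hμ.measurable

/-- The exponential moment, the void probability and the almost sure finiteness below are this
series for particular `f`. -/
theorem lintegral_comp (hμ : IsPoissonProcess P μ) (hA : MeasurableSet A) (hA' : volume A ≠ ∞)
    {f : ℝ≥0∞ → ℝ≥0∞} (hf : Measurable f) :
    ∫⁻ ω, f (μ ω A) ∂P = ∑' n : ℕ, ENNReal.ofReal
      (Real.exp (-volume.real A) * volume.real A ^ n / n.factorial) * f n := by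
  rw [(hμ.law A hA hA').lintegral_comp hf.aemeasurable, lintegral_map hf (by fun_prop),
    poissonMeasure, lintegral_sum_measure]
  refine tsum_congr fun n => ?_
  rw [lintegral_smul_measure, lintegral_dirac]
  rfl

theorem lintegral_exp (hμ : IsPoissonProcess P μ) (hA : MeasurableSet A) (hA' : volume A ≠ ∞)
    (t : ℝ) :
    ∫⁻ ω, ENNReal.ofReal (Real.exp (t * (μ ω A).toReal)) ∂P
      = ENNReal.ofReal (Real.exp (volume.real A * (Real.exp t - 1))) := by
  rw [hμ.lintegral_comp hA hA' (f := fun x => ENNReal.ofReal (Real.exp (t * x.toReal)))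
    (by fun_prop)]
  have key : HasSum (fun n : ℕ => Real.exp (-volume.real A) * volume.real A ^ n / n.factorial
      * Real.exp (t * n)) (Real.exp (volume.real A * (Real.exp t - 1))) := by
    have h := (NormedSpace.expSeries_div_hasSum_exp (volume.real A * Real.exp t)).mul_left
      (Real.exp (-volume.real A))
    rw [← Real.exp_eq_exp_ℝ, ← Real.exp_add] at h
    have h1 : ∀ n : ℕ, Real.exp (-volume.real A) * volume.real A ^ n / n.factorial
        * Real.exp (t * n) = Real.exp (-volume.real A)
          * ((volume.real A * Real.exp t) ^ n / n.factorial) := by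
      intro n
      rw [mul_pow, ← Real.exp_nat_mul, mul_comm t]
      ring
    simp_rw [h1]
    rwa [show volume.real A * (Real.exp t - 1) = -volume.real A + volume.real A * Real.exp t by
      ring]
  rw [← key.tsum_eq, ENNReal.ofReal_tsum_of_nonneg (fun n => by positivity) key.summable]
  refine tsum_congr fun n => ?_
  rw [← ENNReal.ofReal_mul (by positivity)]
  simp

theorem measure_eq_zero (hμ : IsPoissonProcess P μ) (hA : MeasurableSet A) (hA' : volume A ≠ ∞) :
    P {ω | μ ω A = 0} = ENNReal.ofReal (Real.exp (-volume.real A)) := by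
  have h := hμ.lintegral_comp hA hA' (f := ({0} : Set ℝ≥0∞).indicator 1)
    (measurable_one.indicator (measurableSet_singleton 0))
  rw [tsum_eq_single 0 (by intro n hn; simp [hn])] at h
  have h2 : ∀ ω, ({0} : Set ℝ≥0∞).indicator 1 (μ ω A)
      = {ω | μ ω A = 0}.indicator (1 : Ω → ℝ≥0∞) ω := by
    intro ω; simp [Set.indicator_apply]
  simp_rw [h2] at h
  have hm : MeasurableSet {ω | μ ω A = 0} := hμ.measurable_apply hA (measurableSet_singleton 0)
  rw [lintegral_indicator_one hm] at h
  simpa using h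

theorem ae_lt_top (hμ : IsPoissonProcess P μ) (hA : MeasurableSet A) (hA' : volume A ≠ ∞) :
    ∀ᵐ ω ∂P, μ ω A < ∞ := by
  have h := hμ.lintegral_comp hA hA' (f := ({∞} : Set ℝ≥0∞).indicator 1)
    (measurable_one.indicator (measurableSet_singleton ∞))
  have h2 : ∀ ω, ({∞} : Set ℝ≥0∞).indicator 1 (μ ω A)
      = {ω | μ ω A = ∞}.indicator (1 : Ω → ℝ≥0∞) ω := by
    intro ω; simp [Set.indicator_apply]
  simp_rw [h2] at h
  have hm : MeasurableSet {ω | μ ω A = ∞} := hμ.measurable_apply hA (measurableSet_singleton ∞)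
  rw [lintegral_indicator_one hm] at h
  simp only [mem_singleton_iff, ENNReal.natCast_ne_top, not_false_eq_true, indicator_of_notMem,
    mul_zero, tsum_zero] at h
  filter_upwards [measure_eq_zero_iff_ae_notMem.1 h] with ω hω
  exact lt_top_iff_ne_top.2 hω

theorem ae_eq_zero [IsProbabilityMeasure P] (hμ : IsPoissonProcess P μ) (hA : MeasurableSet A)
    (hA' : volume A = 0) : ∀ᵐ ω ∂P, μ ω A = 0 := by
  have h := hμ.measure_eq_zero hA (by simp [hA'])
  rw [measureReal_def, hA'] at h
  have hm : MeasurableSet {ω | μ ω A = 0} := hμ.measurable_apply hA (measurableSet_singleton 0)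
  exact (mem_ae_iff_prob_eq_one hm).2 (by simpa using h)

/-- The atoms have unit mass. This makes every nonempty block have mass at least one, so that
normalizing it does not increase it. -/
theorem one_le_of_pos (hμ : IsPoissonProcess P μ) (hA : MeasurableSet A) {ω : Ω}
    (h : 0 < μ ω A) : 1 ≤ μ ω A := by
  obtain ⟨ι, _, X, hX⟩ := hμ.atomic ω
  rw [hX, Measure.sum_apply _ hA] at h ⊢
  obtain ⟨i, hi⟩ : ∃ i, Measure.dirac (X i) A ≠ 0 := by
    by_contra! hcon
    simp [hcon] at h
  have : X i ∈ A := by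
    by_contra hmem
    exact hi (by simp [Measure.dirac_apply' _ hA, hmem])
  calc (1 : ℝ≥0∞) = Measure.dirac (X i) A := by simp [this]
    _ ≤ _ := ENNReal.le_tsum i

/-- The deviation of the number of points from its mean has an exponential moment on the scale of
its standard deviation. -/
theorem lintegral_exp_abs_sub_le (hμ : IsPoissonProcess P μ) (hA : MeasurableSet A)
    (hA' : volume A ≠ ∞) (h1 : 1 ≤ volume.real A) :
    ∫⁻ ω, ENNReal.ofReal (Real.exp (|(μ ω A).toReal - volume.real A| / √(volume.real A))) ∂P
      ≤ ENNReal.ofReal (2 * Real.exp 1) := by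
  set v := volume.real A with hv
  have hs : 0 < √v := Real.sqrt_pos.2 (by linarith)
  have hs1 : 1 ≤ √v := Real.one_le_sqrt.2 h1
  have hvs : √v * √v = v := Real.mul_self_sqrt (by linarith)
  have hmeas := hμ.measurable_apply hA
  -- Since `|t| ≤ 1`, the exponent `v * (exp t - 1 - t)` is at most `v * t ^ 2 = 1`. The two signs
  -- of `t` then cover the absolute value.
  have aux : ∀ t : ℝ, |t| = 1 / √v →
      ∫⁻ ω, ENNReal.ofReal (Real.exp (t * ((μ ω A).toReal - v))) ∂P
        ≤ ENNReal.ofReal (Real.exp 1) := by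
    intro t ht
    have h2 : ∀ ω, ENNReal.ofReal (Real.exp (t * ((μ ω A).toReal - v)))
        = ENNReal.ofReal (Real.exp (-(t * v)))
          * ENNReal.ofReal (Real.exp (t * (μ ω A).toReal)) := by
      intro ω
      rw [← ENNReal.ofReal_mul (by positivity), ← Real.exp_add]
      ring_nf
    simp_rw [h2]
    rw [lintegral_const_mul _ (by fun_prop), hμ.lintegral_exp hA hA',
      ← ENNReal.ofReal_mul (by positivity), ← Real.exp_add]
    refine ENNReal.ofReal_le_ofReal (Real.exp_le_exp.2 ?_)
    have h3 : |t| ≤ 1 := by rw [ht, div_le_one hs]; exact hs1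
    have h4 := (abs_le.1 (Real.abs_exp_sub_one_sub_id_le h3)).2
    have h5 : t ^ 2 * v = 1 := by
      rw [← sq_abs, ht, div_pow, Real.sq_sqrt (by linarith)]
      field_simp
    nlinarith
  calc ∫⁻ ω, ENNReal.ofReal (Real.exp (|(μ ω A).toReal - v| / √v)) ∂P
      ≤ ∫⁻ ω, (ENNReal.ofReal (Real.exp ((1 / √v) * ((μ ω A).toReal - v)))
        + ENNReal.ofReal (Real.exp ((-(1 / √v)) * ((μ ω A).toReal - v)))) ∂P := by
        refine lintegral_mono fun ω => ?_
        rw [← ENNReal.ofReal_add (by positivity) (by positivity)]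
        refine ENNReal.ofReal_le_ofReal ?_
        rcases abs_cases ((μ ω A).toReal - v) with ⟨h, -⟩ | ⟨h, -⟩ <;> rw [h]
        · rw [show (1 / √v) * ((μ ω A).toReal - v) = ((μ ω A).toReal - v) / √v by ring]
          have := Real.exp_pos ((-(1 / √v)) * ((μ ω A).toReal - v))
          linarith
        · rw [show (-(1 / √v)) * ((μ ω A).toReal - v) = -((μ ω A).toReal - v) / √v by ring]
          have := Real.exp_pos ((1 / √v) * ((μ ω A).toReal - v))
          linarith
    _ ≤ ENNReal.ofReal (Real.exp 1) + ENNReal.ofReal (Real.exp 1) := by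
        rw [lintegral_add_left (by fun_prop)]
        exact add_le_add (aux _ (abs_of_pos (by positivity)))
          (aux _ (by rw [abs_neg]; exact abs_of_pos (by positivity)))
    _ = ENNReal.ofReal (2 * Real.exp 1) := by
        rw [← ENNReal.ofReal_add (by positivity) (by positivity), two_mul]

end IsPoissonProcess

/-! ### Two ways to bound a transportation cost: partial plans and the product coupling. -/

section Transport

variable {d : ℕ} {p : ℝ} {α β : Measure (EuclideanSpace ℝ (Fin d))}

theorem transportCost_le_of_coupling
    (π : Measure (EuclideanSpace ℝ (Fin d) × EuclideanSpace ℝ (Fin d)))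
    (h1 : π.map Prod.fst = α) (h2 : π.map Prod.snd = β) :
    transportCost p α β ≤ ∫⁻ z, edist z.1 z.2 ^ p ∂π :=
  iInf₂_le π ⟨h1, h2⟩

/-- A plan `γ` which moves only mass that is present in `α`, and which balances `α` and `β`, is
completed to a coupling by leaving the remaining mass of `α` where it is. -/
theorem transportCost_le_of_partial_plan (hp : 0 < p) [IsFiniteMeasure α]
    (γ : Measure (EuclideanSpace ℝ (Fin d) × EuclideanSpace ℝ (Fin d)))
    (hle : γ.map Prod.fst ≤ α) (hbal : α + γ.map Prod.snd = β + γ.map Prod.fst) :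
    transportCost p α β ≤ ∫⁻ z, edist z.1 z.2 ^ p ∂γ := by
  have hfin : IsFiniteMeasure (γ.map Prod.fst) := isFiniteMeasure_of_le α hle
  set δ : Measure (EuclideanSpace ℝ (Fin d)) := α - γ.map Prod.fst with hδ
  have hδα : δ + γ.map Prod.fst = α := Measure.sub_add_cancel_of_le hle
  have hdiag : Measurable fun x : EuclideanSpace ℝ (Fin d) => (x, x) := by fun_prop
  have h1 : (δ.map fun x => (x, x)).map Prod.fst = δ := by
    rw [Measure.map_map measurable_fst hdiag]; exact Measure.map_id
  have h2 : (δ.map fun x => (x, x)).map Prod.snd = δ := by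
    rw [Measure.map_map measurable_snd hdiag]; exact Measure.map_id
  refine (transportCost_le_of_coupling (δ.map (fun x => (x, x)) + γ) ?_ ?_).trans ?_
  · rw [Measure.map_add _ _ measurable_fst, h1, hδα]
  · rw [Measure.map_add _ _ measurable_snd, h2]
    -- After adding the first marginal of `γ` to both sides this is `hbal`; that marginal is finite,
    -- being below `α`, and cancels.
    ext s hs
    have hb := congrArg (fun m : Measure (EuclideanSpace ℝ (Fin d)) => m s) hbal
    have ha := congrArg (fun m : Measure (EuclideanSpace ℝ (Fin d)) => m s) hδα
    simp only [Measure.add_apply] at hb ha ⊢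
    rw [← ha, add_right_comm] at hb
    exact (ENNReal.add_left_inj (measure_ne_top _ s)).1 hb
  · rw [lintegral_add_measure, lintegral_map (by fun_prop) hdiag]
    simp [ENNReal.zero_rpow_of_pos hp]

/-- The normalized product of `α` and `β` is a coupling that moves nothing farther than `D`. This
crude bound serves on the exceptional event. -/
theorem transportCost_le_of_edist_le (hp : 0 < p) [IsFiniteMeasure α]
    {R : Set (EuclideanSpace ℝ (Fin d))} (hα : α Rᶜ = 0) (hβ : β Rᶜ = 0)
    (hmass : α univ = β univ) {D : ℝ≥0∞} (hD : ∀ x ∈ R, ∀ y ∈ R, edist x y ≤ D) :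
    transportCost p α β ≤ D ^ p * α univ := by
  rcases eq_or_ne (α univ) 0 with h0 | h0
  · have hα0 : α = 0 := Measure.measure_univ_eq_zero.1 h0
    have hβ0 : β = 0 := Measure.measure_univ_eq_zero.1 (hmass ▸ h0)
    subst hα0 hβ0
    exact (transportCost_le_of_partial_plan hp 0 (by simp) (by simp)).trans (by simp)
  have hβf : IsFiniteMeasure β := ⟨by rw [← hmass]; exact measure_lt_top α univ⟩
  have htop := measure_ne_top α univ
  refine (transportCost_le_of_coupling ((α univ)⁻¹ • α.prod β) ?_ ?_).trans ?_
  · rw [Measure.map_smul, Measure.map_fst_prod, ← hmass, smul_smul,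
      ENNReal.inv_mul_cancel h0 htop, one_smul]
  · rw [Measure.map_smul, Measure.map_snd_prod, smul_smul,
      ENNReal.inv_mul_cancel h0 htop, one_smul]
  · have hae : ∀ᵐ z ∂(α.prod β), edist z.1 z.2 ^ p ≤ D ^ p := by
      have h1 : ∀ᵐ z ∂(α.prod β), z.1 ∈ R := Measure.quasiMeasurePreserving_fst.ae
        (measure_eq_zero_iff_ae_notMem.1 hα |>.mono fun _ h => not_not.1 h)
      have h2 : ∀ᵐ z ∂(α.prod β), z.2 ∈ R := Measure.quasiMeasurePreserving_snd.ae
        (measure_eq_zero_iff_ae_notMem.1 hβ |>.mono fun _ h => not_not.1 h)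
      filter_upwards [h1, h2] with z hz1 hz2
      exact ENNReal.rpow_le_rpow (hD _ hz1 _ hz2) hp.le
    rw [lintegral_smul_measure, smul_eq_mul]
    calc (α univ)⁻¹ * ∫⁻ z, edist z.1 z.2 ^ p ∂(α.prod β)
        ≤ (α univ)⁻¹ * ∫⁻ _, D ^ p ∂(α.prod β) :=
          mul_le_mul_right (lintegral_mono_ae hae) _
      _ = D ^ p * α univ := by
        rw [lintegral_const, ← univ_prod_univ, Measure.prod_prod, ← hmass, mul_left_comm,
          ← mul_assoc (α univ)⁻¹, ENNReal.inv_mul_cancel h0 htop, one_mul]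

end Transport

/-! ### Discrete segments and balls in a cubic grid. -/

section Grid

variable {d n : ℕ}

/-- The `k`-th of the `n + 1` points of the discrete segment from `a` to `b`. -/
def discreteSegment (a b : Fin n) (k : ℕ) : Fin n :=
  -- This is the floor of the affine interpolation at time `k / n`; the truncation `min k n` keeps
  -- it in `Fin n` for every `k`.
  ⟨(a * (n - min k n) + b * min k n) / n, by
    have ha := a.2
    have hb := b.2
    have hn : 0 < n := by omega
    rw [Nat.div_lt_iff_lt_mul hn]
    obtain ⟨m, hm⟩ : ∃ m, n = m + min k n := ⟨n - min k n, by omega⟩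
    have h1 : n - min k n = m := by omega
    rw [h1]
    generalize min k n = k' at hm
    have h2 : (a : ℕ) * m ≤ (n - 1) * m := Nat.mul_le_mul_right _ (by omega)
    have h3 : (b : ℕ) * k' ≤ (n - 1) * k' := Nat.mul_le_mul_right _ (by omega)
    calc (a : ℕ) * m + b * k' ≤ (n - 1) * (m + k') := by rw [mul_add]; omega
      _ < n * n := by rw [← hm]; exact Nat.mul_lt_mul_of_pos_right (by omega) hn⟩

theorem discreteSegment_zero (a b : Fin n) : discreteSegment a b 0 = a := by
  have hn : 0 < n := a.pos
  ext
  simp [discreteSegment, hn]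

theorem discreteSegment_last (a b : Fin n) : discreteSegment a b n = b := by
  have hn : 0 < n := a.pos
  ext
  simp [discreteSegment, hn]

/-- The interpolation before rounding moves by `(b - a) / n`, which is less than one in absolute
value. -/
theorem discreteSegment_succ (a b : Fin n) {k : ℕ} (hk : k < n) :
    (discreteSegment a b k : ℕ) ≤ discreteSegment a b (k + 1) + 1 ∧
      (discreteSegment a b (k + 1) : ℕ) ≤ discreteSegment a b k + 1 := by
  have hn : 0 < n := a.pos
  have ha := a.2
  have hb := b.2
  simp only [discreteSegment, min_eq_left hk.le, min_eq_left (Nat.succ_le_of_lt hk)]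
  obtain ⟨m, rfl⟩ : ∃ m, n = m + (k + 1) := ⟨n - (k + 1), by omega⟩
  have h1 : m + (k + 1) - k = m + 1 := by omega
  have h2 : m + (k + 1) - (k + 1) = m := by omega
  rw [h1, h2, ← Nat.add_div_right _ hn, ← Nat.add_div_right _ hn]
  constructor <;> refine Nat.div_le_div_right ?_
  · rw [Nat.mul_succ, Nat.mul_succ]; omega
  · rw [Nat.mul_succ, Nat.mul_succ]; omega

theorem card_le_two_of_close (S : Finset (Fin n))
    (hS : ∀ b ∈ S, ∀ b' ∈ S, (b' : ℕ) < b + 2) : S.card ≤ 2 := by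
  rcases S.eq_empty_or_nonempty with rfl | hne
  · simp
  have hmin := S.min'_mem hne
  set m := S.min' hne
  have hsub : S.map Fin.valEmbedding ⊆ {(m : ℕ), (m : ℕ) + 1} := by
    intro x hx
    obtain ⟨b, hb, rfl⟩ := Finset.mem_map.1 hx
    have h1 : (m : ℕ) ≤ b := Fin.le_def.1 (S.min'_le b hb)
    have h2 := hS m hmin b hb
    simp only [Fin.valEmbedding_apply, Finset.mem_insert, Finset.mem_singleton]
    omega
  calc S.card = (S.map Fin.valEmbedding).card := (Finset.card_map _).symm
    _ ≤ ({(m : ℕ), (m : ℕ) + 1} : Finset ℕ).card := Finset.card_le_card hsub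
    _ ≤ 2 := Finset.card_le_two

/-- Raising `b` by two raises the numerator by `2 * k ≥ n`, hence the quotient by at least one. -/
theorem close_of_div_eq {c k b b' w : ℕ} (hk : n ≤ 2 * k) (hn : 0 < n)
    (h : (c + b * k) / n = w) (h' : (c + b' * k) / n = w) : b' < b + 2 := by
  by_contra! hcon
  have h1 : (b + 2) * k ≤ b' * k := Nat.mul_le_mul_right _ hcon
  have h2 : (c + b * k + n) / n ≤ (c + b' * k) / n :=
    Nat.div_le_div_right (by rw [add_mul] at h1; omega)
  rw [Nat.add_div_right _ hn] at h2
  omega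

/-- The coefficients of the two endpoints add up to `n`, so one of them is at least `n / 2`. The
other endpoint has `n` possible values, and each of these leaves at most two values for the endpoint
with the large coefficient. -/
theorem card_discreteSegment_eq_le (k : ℕ) (w : Fin n) :
    (Finset.univ.filter fun z : Fin n × Fin n => discreteSegment z.1 z.2 k = w).card ≤ 2 * n := by
  have hn : 0 < n := w.pos
  set S := Finset.univ.filter fun z : Fin n × Fin n => discreteSegment z.1 z.2 k = w with hS
  have hmem : ∀ z ∈ S, ((z.1 : ℕ) * (n - min k n) + z.2 * min k n) / n = w := by
    intro z hz
    exact congrArg Fin.val (Finset.mem_filter.1 hz).2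
  have key : ∀ (f g : Fin n × Fin n → Fin n), (∀ z z', f z = f z' → g z = g z' → z = z') →
      (∀ z ∈ S, ∀ z' ∈ S, f z = f z' → (g z' : ℕ) < g z + 2) → S.card ≤ 2 * n := by
    intro f g hfg h
    refine (Finset.card_le_mul_card_image (f := f) S 2 ?_).trans ?_
    · intro a _
      rw [← Finset.card_image_of_injOn (f := g)]
      · refine card_le_two_of_close _ ?_
        intro b hb b' hb'
        obtain ⟨z, hz, rfl⟩ := Finset.mem_image.1 hb
        obtain ⟨z', hz', rfl⟩ := Finset.mem_image.1 hb'
        rw [Finset.mem_filter] at hz hz'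
        exact h z hz.1 z' hz'.1 (hz.2.trans hz'.2.symm)
      · intro z hz z' hz' hzz
        rw [Finset.mem_coe, Finset.mem_filter] at hz hz'
        exact hfg z z' (hz.2.trans hz'.2.symm) hzz
    · exact Nat.mul_le_mul_left _ ((Finset.card_le_univ _).trans (by simp))
  rcases le_total n (2 * min k n) with hk | hk
  · refine key Prod.fst Prod.snd (fun z z' h1 h2 => Prod.ext h1 h2) ?_
    intro z hz z' hz' hzz
    have h' := hmem z' hz'
    rw [← hzz] at h'
    exact close_of_div_eq hk hn (hmem z hz) h'
  · refine key Prod.snd Prod.fst (fun z z' h1 h2 => Prod.ext h2 h1) ?_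
    intro z hz z' hz' hzz
    have h := hmem z hz
    have h' := hmem z' hz'
    rw [← hzz] at h'
    rw [add_comm] at h h'
    exact close_of_div_eq (by omega) hn h h'

/-- The `k`-th of the `n + 1` points of the discrete segment from `u` to `v` in a cubic grid. -/
def gridPath (u v : Fin d → Fin n) (k : ℕ) : Fin d → Fin n :=
  fun i => discreteSegment (u i) (v i) k

theorem gridPath_zero (u v : Fin d → Fin n) : gridPath u v 0 = u :=
  funext fun _ => discreteSegment_zero _ _

theorem gridPath_last (u v : Fin d → Fin n) : gridPath u v n = v :=
  funext fun _ => discreteSegment_last _ _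

/-- This is the absence of congestion: of the `n ^ (2 * d)` segments, at most `2 ^ d` times the
average number occupy a given site at a given time. The count factors over the coordinates. -/
theorem card_gridPath_eq_le (k : ℕ) (w : Fin d → Fin n) :
    (Finset.univ.filter fun z : (Fin d → Fin n) × (Fin d → Fin n) =>
      gridPath z.1 z.2 k = w).card ≤ (2 * n) ^ d := by
  calc _ ≤ (Fintype.piFinset fun i => Finset.univ.filter
        fun z : Fin n × Fin n => discreteSegment z.1 z.2 k = w i).card := by
        refine Finset.card_le_card_of_injOn (fun z i => (z.1 i, z.2 i)) ?_ ?_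
        · intro z hz
          rw [Finset.mem_coe, Finset.mem_filter] at hz
          rw [Finset.mem_coe, Fintype.mem_piFinset]
          intro i
          exact Finset.mem_filter.2 ⟨Finset.mem_univ _, congrFun hz.2 i⟩
        · intro z _ z' _ h
          refine Prod.ext (funext fun i => ?_) (funext fun i => ?_)
          · exact congrArg Prod.fst (congrFun h i)
          · exact congrArg Prod.snd (congrFun h i)
    _ ≤ ∏ _i : Fin d, 2 * n := by
        rw [Fintype.card_piFinset]
        exact Finset.prod_le_prod' fun i _ => card_discreteSegment_eq_le k (w i)
    _ = (2 * n) ^ d := by simp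

/-- The ball of radius `k` around `t` in a cubic grid, for the supremum distance. -/
def gridBall (t : Fin d → Fin n) (k : ℕ) : Finset (Fin d → Fin n) :=
  Fintype.piFinset fun i => Finset.univ.filter fun j : Fin n =>
    (t i : ℕ) ≤ j + k ∧ (j : ℕ) ≤ t i + k

theorem mem_gridBall {t w : Fin d → Fin n} {k : ℕ} :
    w ∈ gridBall t k ↔ ∀ i, (t i : ℕ) ≤ w i + k ∧ (w i : ℕ) ≤ t i + k := by
  simp [gridBall]

theorem mem_gridBall_comm {t w : Fin d → Fin n} {k : ℕ} :
    w ∈ gridBall t k ↔ t ∈ gridBall w k := by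
  simp only [mem_gridBall, and_comm]

theorem mem_gridBall_mono {t w : Fin d → Fin n} {k l : ℕ} (hkl : k ≤ l) (h : w ∈ gridBall t k) :
    w ∈ gridBall t l := by
  rw [mem_gridBall] at h ⊢
  intro i
  have := h i
  omega

theorem mem_gridBall_trans {s t w : Fin d → Fin n} {k l : ℕ} (h1 : t ∈ gridBall s k)
    (h2 : w ∈ gridBall t l) : w ∈ gridBall s (k + l) := by
  rw [mem_gridBall] at h1 h2 ⊢
  intro i
  have := h1 i
  have := h2 i
  omega

theorem gridBall_size (t : Fin d → Fin n) : gridBall t n = Finset.univ := by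
  ext w
  simp only [mem_gridBall, Finset.mem_univ, iff_true]
  intro i
  have := (t i).2
  have := (w i).2
  omega

theorem gridPath_succ_mem_gridBall (u v : Fin d → Fin n) {k : ℕ} (hk : k < n) :
    gridPath u v (k + 1) ∈ gridBall (gridPath u v k) 1 :=
  mem_gridBall.2 fun i => discreteSegment_succ (u i) (v i) hk

theorem card_gridBall_le (t : Fin d → Fin n) (k : ℕ) : (gridBall t k).card ≤ (2 * k + 1) ^ d := by
  rw [gridBall, Fintype.card_piFinset]
  calc _ ≤ ∏ _i : Fin d, (2 * k + 1) := Finset.prod_le_prod' fun i _ => ?_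
    _ = (2 * k + 1) ^ d := by simp
  rw [← Finset.card_map Fin.valEmbedding]
  calc _ ≤ (Finset.Icc ((t i : ℕ) - k) (t i + k)).card := by
        refine Finset.card_le_card fun x hx => ?_
        simp only [Finset.mem_map, Finset.mem_filter, Finset.mem_univ, true_and,
          Fin.valEmbedding_apply] at hx
        obtain ⟨j, hj, rfl⟩ := hx
        rw [Finset.mem_Icc]
        omega
    _ ≤ 2 * k + 1 := by rw [Nat.card_Icc]; omega

/-- One coordinate direction alone provides `k + 1` sites. Linear growth is enough, as it makes the
void probabilities decay exponentially in `k`. -/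
theorem lt_card_gridBall (hd : 0 < d) (t : Fin d → Fin n) {k : ℕ} (hk : k < n) :
    k < (gridBall t k).card := by
  rw [gridBall, Fintype.card_piFinset]
  have h1 : ∀ i : Fin d, k + 1 ≤ (Finset.univ.filter fun j : Fin n =>
      (t i : ℕ) ≤ j + k ∧ (j : ℕ) ≤ t i + k).card := by
    intro i
    have ht := (t i).2
    calc k + 1 = (Finset.univ : Finset (Fin (k + 1))).card := by simp
      _ ≤ _ := Finset.card_le_card_of_injOn
        -- The truncated subtraction handles the boundary: the window is `[t i - k, t i]` when `k ≤
        -- t i`, and `[0, k]` otherwise.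
        (fun j => (⟨(t i : ℕ) - k + j, by have := j.2; omega⟩ : Fin n)) ?_ ?_
    · intro j _
      have := j.2
      rw [Finset.mem_coe, Finset.mem_filter]
      refine ⟨Finset.mem_univ _, ?_⟩
      simp only
      omega
    · intro j _ j' _ h
      have := congrArg Fin.val h
      simp only at this
      exact Fin.ext (by omega)
  calc k + 1 = ∏ i ∈ {(⟨0, hd⟩ : Fin d)}, (k + 1) := by simp
    _ ≤ ∏ _i : Fin d, (k + 1) := Finset.prod_le_prod_of_subset_of_one_le'
        (Finset.subset_univ _) (fun _ _ _ => by omega)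
    _ ≤ _ := Finset.prod_le_prod' fun i _ => h1 i

end Grid

/-! ### Spreading mass over the grid in short hops. -/

section GridTransport

variable {d n : ℕ}

/-- The restriction of `lam` to the union of the cells in the ball of radius `r t` around `t`. -/
noncomputable def blockMeasure (lam : Measure (EuclideanSpace ℝ (Fin d)))
    (Q : (Fin d → Fin n) → Set (EuclideanSpace ℝ (Fin d))) (r : (Fin d → Fin n) → ℕ)
    (t : Fin d → Fin n) : Measure (EuclideanSpace ℝ (Fin d)) :=
  ∑ w ∈ gridBall t (r t), lam.restrict (Q w)

/-- The normalization of `blockMeasure`. -/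
noncomputable def blockLaw (lam : Measure (EuclideanSpace ℝ (Fin d)))
    (Q : (Fin d → Fin n) → Set (EuclideanSpace ℝ (Fin d))) (r : (Fin d → Fin n) → ℕ)
    (t : Fin d → Fin n) : Measure (EuclideanSpace ℝ (Fin d)) :=
  (blockMeasure lam Q r t univ)⁻¹ • blockMeasure lam Q r t

/-- The mass distribution after `k` hops, when the mass of `E` in each cell is sent to uniformly
distributed cells along discrete segments. -/
noncomputable def hopMeasure (lam E : Measure (EuclideanSpace ℝ (Fin d)))
    (Q : (Fin d → Fin n) → Set (EuclideanSpace ℝ (Fin d))) (r : (Fin d → Fin n) → ℕ) (k : ℕ) :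
    Measure (EuclideanSpace ℝ (Fin d)) :=
  ∑ z : (Fin d → Fin n) × (Fin d → Fin n),
    (E (Q z.1) / (n : ℝ≥0∞) ^ d) • blockLaw lam Q r (gridPath z.1 z.2 k)

/-- The plan which spreads the mass of `E` uniformly over the cells, in `n` short hops. -/
noncomputable def hopPlan (lam E : Measure (EuclideanSpace ℝ (Fin d)))
    (Q : (Fin d → Fin n) → Set (EuclideanSpace ℝ (Fin d))) (r : (Fin d → Fin n) → ℕ) :
    Measure (EuclideanSpace ℝ (Fin d) × EuclideanSpace ℝ (Fin d)) :=
  ∑ u, (E.restrict (Q u)).prod (blockLaw lam Q r u) +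
    ∑ k ∈ Finset.range n, ∑ z : (Fin d → Fin n) × (Fin d → Fin n),
      (E (Q z.1) / (n : ℝ≥0∞) ^ d) •
        (blockLaw lam Q r (gridPath z.1 z.2 k)).prod (blockLaw lam Q r (gridPath z.1 z.2 (k + 1)))

variable {lam E : Measure (EuclideanSpace ℝ (Fin d))}
  {Q : (Fin d → Fin n) → Set (EuclideanSpace ℝ (Fin d))} {r : (Fin d → Fin n) → ℕ}

theorem blockMeasure_univ (t : Fin d → Fin n) :
    blockMeasure lam Q r t univ = ∑ w ∈ gridBall t (r t), lam (Q w) := by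
  simp [blockMeasure, Measure.finsetSum_apply]

theorem blockMeasure_univ_ne_top [IsFiniteMeasure lam] (t : Fin d → Fin n) : blockMeasure lam Q r t univ ≠ ∞ := by
  rw [blockMeasure_univ]
  exact (ENNReal.sum_lt_top.2 fun w _ => measure_lt_top lam _).ne

theorem isProbabilityMeasure_blockLaw
    [IsFiniteMeasure lam] (hr : ∀ t, 1 ≤ ∑ w ∈ gridBall t (r t), lam (Q w)) (t : Fin d → Fin n) :
    IsProbabilityMeasure (blockLaw lam Q r t) := by
  refine ⟨?_⟩
  rw [blockLaw, Measure.smul_apply, smul_eq_mul]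
  refine ENNReal.inv_mul_cancel ?_ (blockMeasure_univ_ne_top t)
  rw [blockMeasure_univ]
  exact (zero_lt_one.trans_le (hr t)).ne'

/-- Blocks have mass at least one, so normalization only shrinks them. This is how probability
measures on blocks are controlled by `lam`. -/
theorem blockLaw_le (hr : ∀ t, 1 ≤ ∑ w ∈ gridBall t (r t), lam (Q w)) (t : Fin d → Fin n) :
    blockLaw lam Q r t ≤ blockMeasure lam Q r t := by
  have h : (blockMeasure lam Q r t univ)⁻¹ ≤ 1 := by
    rw [ENNReal.inv_le_one, blockMeasure_univ]; exact hr t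
  refine Measure.le_iff.2 fun s _ => ?_
  rw [blockLaw, Measure.smul_apply, smul_eq_mul]
  exact mul_le_of_le_one_left' h

theorem ae_blockLaw (hQm : ∀ u, MeasurableSet (Q u)) (t : Fin d → Fin n) :
    ∀ᵐ x ∂(blockLaw lam Q r t), ∃ w ∈ gridBall t (r t), x ∈ Q w := by
  refine Measure.ae_smul_measure ?_ _
  rw [ae_iff, blockMeasure, Measure.finsetSum_apply]
  refine Finset.sum_eq_zero fun w hw => ?_
  rw [← ae_iff (μ := lam.restrict (Q w)) (p := fun x => ∃ w ∈ gridBall t (r t), x ∈ Q w)]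
  filter_upwards [ae_restrict_mem (hQm w)] with x hx
  exact ⟨w, hw, hx⟩

theorem hopMeasure_zero (hn : 0 < n) :
    hopMeasure lam E Q r 0 = ∑ u, E (Q u) • blockLaw lam Q r u := by
  rw [hopMeasure, Fintype.sum_prod_type]
  refine Finset.sum_congr rfl fun u _ => ?_
  simp only [gridPath_zero]
  rw [Finset.sum_const, ← Nat.cast_smul_eq_nsmul ℝ≥0∞, smul_smul]
  congr 1
  have h0 : (n : ℝ≥0∞) ^ d ≠ 0 := pow_ne_zero _ (by exact_mod_cast hn.ne')
  have h1 : (n : ℝ≥0∞) ^ d ≠ ∞ := ENNReal.pow_ne_top (ENNReal.natCast_ne_top n)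
  simp only [Finset.card_univ, Fintype.card_fun, Fintype.card_fin, Nat.cast_pow]
  exact ENNReal.mul_div_cancel h0 h1

/-- At time `n` all paths are at their uniformly chosen endpoint. The result depends on `E` only
through its total mass, so the flows of two measures of equal mass meet. -/
theorem hopMeasure_last (hE : E = ∑ u, E.restrict (Q u)) :
    hopMeasure lam E Q r n = ∑ v, (E univ / (n : ℝ≥0∞) ^ d) • blockLaw lam Q r v := by
  have hE' : E univ = ∑ u, E (Q u) := by
    conv_lhs => rw [hE]
    simp [Measure.finsetSum_apply]
  rw [hopMeasure, Fintype.sum_prod_type_right]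
  refine Finset.sum_congr rfl fun v _ => ?_
  simp only [gridPath_last]
  rw [← Finset.sum_smul, hE']
  simp only [div_eq_mul_inv, Finset.sum_mul]

/-- Together with `map_snd_hopPlan` this telescopes: hop `k` takes `hopMeasure k` to `hopMeasure (k
+ 1)`, so all hops at once only replace `E` by the final measure. -/
theorem map_fst_hopPlan [IsFiniteMeasure lam] (hr : ∀ t, 1 ≤ ∑ w ∈ gridBall t (r t), lam (Q w))
    (hE : E = ∑ u, E.restrict (Q u)) :
    (hopPlan lam E Q r).map Prod.fst = E + ∑ k ∈ Finset.range n, hopMeasure lam E Q r k := by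
  have := isProbabilityMeasure_blockLaw hr
  rw [hopPlan, Measure.map_add _ _ measurable_fst,
    Measure.map_finset_sum measurable_fst.aemeasurable,
    Measure.map_finset_sum measurable_fst.aemeasurable]
  congr 1
  · conv_rhs => rw [hE]
    refine Finset.sum_congr rfl fun u _ => ?_
    rw [Measure.map_fst_prod, measure_univ, one_smul]
  · refine Finset.sum_congr rfl fun k _ => ?_
    rw [Measure.map_finset_sum measurable_fst.aemeasurable, hopMeasure]
    refine Finset.sum_congr rfl fun z _ => ?_
    rw [Measure.map_smul, Measure.map_fst_prod, measure_univ, one_smul]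

theorem map_snd_hopPlan [IsFiniteMeasure lam] (hn : 0 < n) (hr : ∀ t, 1 ≤ ∑ w ∈ gridBall t (r t), lam (Q w)) :
    (hopPlan lam E Q r).map Prod.snd = ∑ k ∈ Finset.range (n + 1), hopMeasure lam E Q r k := by
  have := isProbabilityMeasure_blockLaw hr
  rw [hopPlan, Measure.map_add _ _ measurable_snd,
    Measure.map_finset_sum measurable_snd.aemeasurable,
    Measure.map_finset_sum measurable_snd.aemeasurable, Finset.sum_range_succ', add_comm]
  congr 1
  · refine Finset.sum_congr rfl fun k _ => ?_
    rw [Measure.map_finset_sum measurable_snd.aemeasurable, hopMeasure]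
    refine Finset.sum_congr rfl fun z _ => ?_
    rw [Measure.map_smul, Measure.map_snd_prod, measure_univ, one_smul]
  · rw [hopMeasure_zero hn]
    refine Finset.sum_congr rfl fun u _ => ?_
    rw [Measure.map_snd_prod, Measure.restrict_apply_univ]

/-- Balls are symmetric, so a cell lies in the blocks of at most `(2 * T + 1) ^ d` centres. -/
theorem sum_blockMeasure_le (hlam : lam = ∑ u, lam.restrict (Q u)) {T : ℕ} (hT : ∀ t, r t ≤ T) :
    ∑ t, blockMeasure lam Q r t ≤ ((2 * T + 1 : ℕ) : ℝ≥0∞) ^ d • lam := by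
  refine Measure.le_iff.2 fun s _ => ?_
  rw [Measure.finsetSum_apply, Measure.smul_apply, smul_eq_mul]
  conv_rhs => rw [hlam]
  rw [Measure.finsetSum_apply, Finset.mul_sum]
  calc ∑ t, blockMeasure lam Q r t s
      ≤ ∑ t, ∑ w ∈ gridBall t T, lam.restrict (Q w) s := by
        refine Finset.sum_le_sum fun t _ => ?_
        rw [blockMeasure, Measure.finsetSum_apply]
        exact Finset.sum_le_sum_of_subset fun w hw => mem_gridBall_mono (hT t) hw
    _ = ∑ w, ∑ t ∈ gridBall w T, lam.restrict (Q w) s :=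
        Finset.sum_comm' fun t w => by simp [mem_gridBall_comm (t := t)]
    _ ≤ ∑ w, ((2 * T + 1 : ℕ) : ℝ≥0∞) ^ d * lam.restrict (Q w) s := by
        refine Finset.sum_le_sum fun w _ => ?_
        rw [Finset.sum_const, nsmul_eq_mul]
        gcongr
        exact_mod_cast card_gridBall_le w T

/-- At time `k` a site is visited by at most `(2 * n) ^ d` paths carrying at most `e / n ^ d` each;
the last factor accounts for the overlap of the blocks. -/
theorem hopMeasure_le (hn : 0 < n) (hr : ∀ t, 1 ≤ ∑ w ∈ gridBall t (r t), lam (Q w))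
    (hlam : lam = ∑ u, lam.restrict (Q u)) {T : ℕ} (hT : ∀ t, r t ≤ T) {e : ℝ≥0∞}
    (he : ∀ u, E (Q u) ≤ e) (k : ℕ) :
    hopMeasure lam E Q r k ≤ (e * 2 ^ d * ((2 * T + 1 : ℕ) : ℝ≥0∞) ^ d) • lam := by
  have h0 : (n : ℝ≥0∞) ^ d ≠ 0 := pow_ne_zero _ (by exact_mod_cast hn.ne')
  have h1 : (n : ℝ≥0∞) ^ d ≠ ∞ := ENNReal.pow_ne_top (ENNReal.natCast_ne_top n)
  refine Measure.le_iff.2 fun s hs => ?_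
  rw [hopMeasure, Measure.finsetSum_apply]
  calc ∑ z : (Fin d → Fin n) × (Fin d → Fin n),
        ((E (Q z.1) / (n : ℝ≥0∞) ^ d) • blockLaw lam Q r (gridPath z.1 z.2 k)) s
      ≤ ∑ z : (Fin d → Fin n) × (Fin d → Fin n),
        (e / (n : ℝ≥0∞) ^ d) * blockMeasure lam Q r (gridPath z.1 z.2 k) s := by
        refine Finset.sum_le_sum fun z _ => ?_
        rw [Measure.smul_apply, smul_eq_mul]
        gcongr
        · exact he _
        · exact blockLaw_le hr _
    _ = ∑ t, ∑ z : (Fin d → Fin n) × (Fin d → Fin n) with gridPath z.1 z.2 k = t,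
        (e / (n : ℝ≥0∞) ^ d) * blockMeasure lam Q r (gridPath z.1 z.2 k) s :=
        (Finset.sum_fiberwise _ _ _).symm
    _ = ∑ t, ∑ z : (Fin d → Fin n) × (Fin d → Fin n) with gridPath z.1 z.2 k = t,
        (e / (n : ℝ≥0∞) ^ d) * blockMeasure lam Q r t s := by
        refine Finset.sum_congr rfl fun t _ => Finset.sum_congr rfl fun z hz => ?_
        rw [(Finset.mem_filter.1 hz).2]
    _ ≤ ∑ t, (e * 2 ^ d) * blockMeasure lam Q r t s := by
        refine Finset.sum_le_sum fun t _ => ?_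
        rw [Finset.sum_const, nsmul_eq_mul, ← mul_assoc]
        gcongr ?_ * _
        calc _ ≤ ((2 * n) ^ d : ℝ≥0∞) * (e / (n : ℝ≥0∞) ^ d) := by
              gcongr
              exact_mod_cast card_gridPath_eq_le k t
          _ = e * 2 ^ d := by
              rw [mul_pow, mul_assoc, ENNReal.mul_div_cancel h0 h1, mul_comm]
    _ = (e * 2 ^ d) * (∑ t, blockMeasure lam Q r t) s := by
        rw [Measure.finsetSum_apply, Finset.mul_sum]
    _ ≤ (e * 2 ^ d) * (((2 * T + 1 : ℕ) : ℝ≥0∞) ^ d • lam) s := by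
        gcongr
        exact sum_blockMeasure_le hlam hT
    _ = _ := by
        rw [Measure.smul_apply, Measure.smul_apply, smul_eq_mul, smul_eq_mul, ← mul_assoc]

/-- Since `a + b + 2` is at most twice the larger of `a + 1` and `b + 1`, the cost of a hop splits
into one term for each block radius. -/
theorem rpow_edist_le {p : ℝ} (hp : 0 < p) {D : ℝ≥0∞} {a b : ℕ} {δ : ℝ≥0∞}
    (h : δ ≤ D * ((a + b + 1 : ℕ) + 1)) :
    δ ^ p ≤ (2 * D) ^ p * (((a + 1 : ℕ) : ℝ≥0∞) ^ p + ((b + 1 : ℕ) : ℝ≥0∞) ^ p) := by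
  wlog hab : b ≤ a generalizing a b
  · rw [add_comm (((a + 1 : ℕ) : ℝ≥0∞) ^ p)]
    exact this (by rwa [add_comm b a]) (by omega)
  calc δ ^ p ≤ (2 * D * ((a + 1 : ℕ) : ℝ≥0∞)) ^ p := by
        refine ENNReal.rpow_le_rpow (h.trans ?_) hp.le
        rw [mul_comm 2 D, mul_assoc]
        gcongr
        exact_mod_cast (by omega : a + b + 1 + 1 ≤ 2 * (a + 1))
    _ = (2 * D) ^ p * ((a + 1 : ℕ) : ℝ≥0∞) ^ p := ENNReal.mul_rpow_of_nonneg _ _ hp.le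
    _ ≤ _ := by gcongr; exact le_self_add

theorem lintegral_prod_le_of_ae {μ ν : Measure (EuclideanSpace ℝ (Fin d))} [SFinite μ] [SFinite ν]
    {f : EuclideanSpace ℝ (Fin d) × EuclideanSpace ℝ (Fin d) → ℝ≥0∞} {c : ℝ≥0∞}
    {p q : EuclideanSpace ℝ (Fin d) → Prop} (hμ : ∀ᵐ x ∂μ, p x) (hν : ∀ᵐ y ∂ν, q y)
    (hf : ∀ x y, p x → q y → f (x, y) ≤ c) :
    ∫⁻ z, f z ∂(μ.prod ν) ≤ μ univ * ν univ * c := by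
  have h1 : ∀ᵐ z ∂(μ.prod ν), p z.1 := Measure.quasiMeasurePreserving_fst.ae hμ
  have h2 : ∀ᵐ z ∂(μ.prod ν), q z.2 := Measure.quasiMeasurePreserving_snd.ae hν
  calc ∫⁻ z, f z ∂(μ.prod ν) ≤ ∫⁻ _, c ∂(μ.prod ν) := by
        refine lintegral_mono_ae ?_
        filter_upwards [h1, h2] with z hz1 hz2
        exact hf _ _ hz1 hz2
    _ = _ := by rw [lintegral_const, ← univ_prod_univ, Measure.prod_prod, mul_comm]

theorem lintegral_hopPlan_le [IsFiniteMeasure lam] {p : ℝ} (hp : 0 < p) (hQm : ∀ u, MeasurableSet (Q u))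
    [IsFiniteMeasure E] (hr : ∀ t, 1 ≤ ∑ w ∈ gridBall t (r t), lam (Q w)) {D : ℝ≥0∞}
    (hD : ∀ u w k, w ∈ gridBall u k → ∀ x ∈ Q u, ∀ y ∈ Q w, edist x y ≤ D * (k + 1)) :
    ∫⁻ z, edist z.1 z.2 ^ p ∂(hopPlan lam E Q r) ≤
      ∑ u, E (Q u) * ((2 * D) ^ p * ((r u + 1 : ℕ) : ℝ≥0∞) ^ p) +
        ∑ k ∈ Finset.range n, ∑ z : (Fin d → Fin n) × (Fin d → Fin n),
          (E (Q z.1) / (n : ℝ≥0∞) ^ d) * ((2 * D) ^ p *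
            (((r (gridPath z.1 z.2 k) + 1 : ℕ) : ℝ≥0∞) ^ p +
              ((r (gridPath z.1 z.2 (k + 1)) + 1 : ℕ) : ℝ≥0∞) ^ p)) := by
  have := isProbabilityMeasure_blockLaw hr
  rw [hopPlan, lintegral_add_measure, lintegral_finsetSum_measure, lintegral_finsetSum_measure]
  refine add_le_add (Finset.sum_le_sum fun u _ => ?_) (Finset.sum_le_sum fun k hk => ?_)
  · refine (lintegral_prod_le_of_ae (ae_restrict_mem (hQm u)) (ae_blockLaw hQm u)
      (c := (2 * D) ^ p * ((r u + 1 : ℕ) : ℝ≥0∞) ^ p) ?_).trans (by simp)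
    rintro x y hx ⟨w, hw, hy⟩
    rw [← ENNReal.mul_rpow_of_nonneg _ _ hp.le]
    refine ENNReal.rpow_le_rpow ((hD u w _ hw x hx y hy).trans ?_) hp.le
    push_cast
    gcongr
    exact le_mul_of_one_le_left' (by norm_num)
  · rw [lintegral_finsetSum_measure]
    refine Finset.sum_le_sum fun z _ => ?_
    rw [lintegral_smul_measure, smul_eq_mul]
    gcongr
    refine (lintegral_prod_le_of_ae (ae_blockLaw hQm _) (ae_blockLaw hQm _)
      (c := (2 * D) ^ p * (((r (gridPath z.1 z.2 k) + 1 : ℕ) : ℝ≥0∞) ^ p +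
              ((r (gridPath z.1 z.2 (k + 1)) + 1 : ℕ) : ℝ≥0∞) ^ p)) ?_).trans (by simp)
    rintro x y ⟨w, hw, hx⟩ ⟨w', hw', hy⟩
    refine rpow_edist_le hp ?_
    -- The points are separated by the first radius, one grid step between the centres, and the
    -- second radius.
    have h1 := mem_gridBall_trans (mem_gridBall_trans (mem_gridBall_comm.1 hw)
      (gridPath_succ_mem_gridBall z.1 z.2 (Finset.mem_range.1 hk))) hw'
    refine (hD w w' _ h1 x hx y hy).trans (le_of_eq ?_)
    congr 3
    omega

theorem eq_sum_restrict {ι : Type*} [Fintype ι] {Q : ι → Set (EuclideanSpace ℝ (Fin d))}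
    (hQm : ∀ u, MeasurableSet (Q u)) (hQd : Pairwise (Function.onFun Disjoint Q))
    {F : Measure (EuclideanSpace ℝ (Fin d))} (hF : F (⋃ u, Q u)ᶜ = 0) :
    F = ∑ u, F.restrict (Q u) := by
  conv_lhs => rw [← Measure.restrict_eq_self_of_ae_mem (s := ⋃ u, Q u)
    ((measure_eq_zero_iff_ae_notMem.1 hF).mono fun _ h => not_not.1 h)]
  rw [Measure.restrict_iUnion hQd hQm, Measure.sum_fintype]

/-- Two measures which differ from each other by at most a small multiple of `lam` are coupled by
moving mass between points of `lam` that are close to each other. -/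
theorem transportCost_le_of_grid [IsFiniteMeasure lam] {p : ℝ} (hp : 0 < p) (hn : 0 < n)
    {α β E' : Measure (EuclideanSpace ℝ (Fin d))} [IsFiniteMeasure α]
    (hQm : ∀ u, MeasurableSet (Q u)) (hQd : Pairwise (Function.onFun Disjoint Q))
    (hQ : lam (⋃ u, Q u)ᶜ = 0)
    (hr : ∀ t, 1 ≤ ∑ w ∈ gridBall t (r t), lam (Q w)) {D : ℝ≥0∞}
    (hD : ∀ u w k, w ∈ gridBall u k → ∀ x ∈ Q u, ∀ y ∈ Q w, edist x y ≤ D * (k + 1))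
    {T : ℕ} (hT : ∀ t, r t ≤ T) (hS : ∀ u, lam (Q u) ≤ T) {h : ℝ≥0∞} (hh : h ≠ ∞)
    (hE : E ≤ h • lam) (hE' : E' ≤ h • lam) (hbal : α + E' = β + E) (hmass : E univ = E' univ)
    (hcap : (h * (1 + (2 * n + 1) * (T * 2 ^ d * ((2 * T + 1 : ℕ) : ℝ≥0∞) ^ d))) • lam ≤ α) :
    transportCost p α β ≤ 2 * h * (2 * D) ^ p *
      (∑ u, lam (Q u) * ((r u + 1 : ℕ) : ℝ≥0∞) ^ p +
        ((n : ℝ≥0∞) ^ d)⁻¹ * ∑ k ∈ Finset.range n, ∑ z : (Fin d → Fin n) × (Fin d → Fin n),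
          lam (Q z.1) * (((r (gridPath z.1 z.2 k) + 1 : ℕ) : ℝ≥0∞) ^ p +
              ((r (gridPath z.1 z.2 (k + 1)) + 1 : ℕ) : ℝ≥0∞) ^ p)) := by
  have hprob := isProbabilityMeasure_blockLaw hr
  have hfinh : IsFiniteMeasure (h • lam) := lam.smul_finite hh
  have hconc : ∀ F : Measure (EuclideanSpace ℝ (Fin d)), F ≤ h • lam →
      F = ∑ u, F.restrict (Q u) := fun F hF =>
    eq_sum_restrict hQm hQd (le_antisymm ((hF _).trans (by rw [Measure.smul_apply, hQ, smul_zero])) zero_le)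
  have hlam := eq_sum_restrict hQm hQd hQ
  have hEf : IsFiniteMeasure E := isFiniteMeasure_of_le _ hE
  have hEf' : IsFiniteMeasure E' := isFiniteMeasure_of_le _ hE'
  have hEc := hconc E hE
  have hEc' := hconc E' hE'
  have hcell : ∀ F : Measure (EuclideanSpace ℝ (Fin d)), F ≤ h • lam →
      ∀ u, F (Q u) ≤ h * lam (Q u) := fun F hF u => hF (Q u)
  have hcellT : ∀ F : Measure (EuclideanSpace ℝ (Fin d)), F ≤ h • lam → ∀ u, F (Q u) ≤ h * T :=
    fun F hF u => (hcell F hF u).trans (by gcongr; exact hS u)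
  have hcost : ∀ F : Measure (EuclideanSpace ℝ (Fin d)), F ≤ h • lam →
      ∫⁻ z, edist z.1 z.2 ^ p ∂(hopPlan lam F Q r) ≤ h * (2 * D) ^ p *
      (∑ u, lam (Q u) * ((r u + 1 : ℕ) : ℝ≥0∞) ^ p +
        ((n : ℝ≥0∞) ^ d)⁻¹ * ∑ k ∈ Finset.range n, ∑ z : (Fin d → Fin n) × (Fin d → Fin n),
          lam (Q z.1) * (((r (gridPath z.1 z.2 k) + 1 : ℕ) : ℝ≥0∞) ^ p +
              ((r (gridPath z.1 z.2 (k + 1)) + 1 : ℕ) : ℝ≥0∞) ^ p)) := by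
    intro F hF
    have : IsFiniteMeasure F := isFiniteMeasure_of_le _ hF
    refine (lintegral_hopPlan_le hp hQm hr hD).trans ?_
    rw [mul_add, Finset.mul_sum, Finset.mul_sum, Finset.mul_sum]
    refine add_le_add (Finset.sum_le_sum fun u _ => ?_) (Finset.sum_le_sum fun k _ => ?_)
    · calc _ ≤ (h * lam (Q u)) * ((2 * D) ^ p * ((r u + 1 : ℕ) : ℝ≥0∞) ^ p) := by
            gcongr; exact hcell F hF u
        _ = _ := by ring
    · rw [Finset.mul_sum, Finset.mul_sum]
      refine Finset.sum_le_sum fun z _ => ?_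
      rw [div_eq_mul_inv]
      calc _ ≤ (h * lam (Q z.1)) * ((n : ℝ≥0∞) ^ d)⁻¹ * ((2 * D) ^ p *
            (((r (gridPath z.1 z.2 k) + 1 : ℕ) : ℝ≥0∞) ^ p +
              ((r (gridPath z.1 z.2 (k + 1)) + 1 : ℕ) : ℝ≥0∞) ^ p)) := by
            gcongr; exact hcell F hF _
        _ = _ := by ring
  -- The surplus `E` flows out to the uniform spread, and the flow of `E'` is run backwards from
  -- there.
  set γ := hopPlan lam E Q r + (hopPlan lam E' Q r).map Prod.swap with hγ
  have hfst : γ.map Prod.fst = (hopPlan lam E Q r).map Prod.fst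
      + (hopPlan lam E' Q r).map Prod.snd := by
    rw [hγ, Measure.map_add _ _ measurable_fst, Measure.map_map measurable_fst measurable_swap]
    rfl
  have hsnd : γ.map Prod.snd = (hopPlan lam E Q r).map Prod.snd
      + (hopPlan lam E' Q r).map Prod.fst := by
    rw [hγ, Measure.map_add _ _ measurable_snd, Measure.map_map measurable_snd measurable_swap]
    rfl
  rw [map_fst_hopPlan hr hEc, map_snd_hopPlan hn hr] at hfst
  rw [map_fst_hopPlan hr hEc', map_snd_hopPlan hn hr] at hsnd
  refine (transportCost_le_of_partial_plan hp γ ?_ ?_).trans ?_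
  -- The outgoing mass consists of `E`, of `n` hop measures from the flow of `E` and of `n + 1` from
  -- the reversed flow, whence the factor `2 * n + 1` in `hcap`.
  · refine le_trans ?_ hcap
    rw [hfst]
    refine Measure.le_iff.2 fun s _ => ?_
    simp only [Measure.add_apply, Measure.finsetSum_apply, Measure.smul_apply, smul_eq_mul]
    have hb : ∀ F : Measure (EuclideanSpace ℝ (Fin d)), F ≤ h • lam → ∀ k,
        hopMeasure lam F Q r k s ≤ h * T * 2 ^ d * ((2 * T + 1 : ℕ) : ℝ≥0∞) ^ d * lam s :=
      fun F hF k => hopMeasure_le hn hr hlam hT (hcellT F hF) k s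
    calc _ ≤ h * lam s
        + ∑ _k ∈ Finset.range n, h * T * 2 ^ d * ((2 * T + 1 : ℕ) : ℝ≥0∞) ^ d * lam s
        + ∑ _k ∈ Finset.range (n + 1), h * T * 2 ^ d * ((2 * T + 1 : ℕ) : ℝ≥0∞) ^ d * lam s := by
          gcongr
          · exact hE s
          · exact hb E hE _
          · exact hb E' hE' _
      _ = _ := by
          rw [Finset.sum_const, Finset.sum_const, Finset.card_range, Finset.card_range,
            nsmul_eq_mul, nsmul_eq_mul]
          push_cast
          ring
  · rw [hfst, hsnd, Finset.sum_range_succ, Finset.sum_range_succ, hopMeasure_last hEc,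
      hopMeasure_last hEc', ← hmass]
    rw [show α + (∑ k ∈ Finset.range n, hopMeasure lam E Q r k +
        ∑ v, (E univ / (n : ℝ≥0∞) ^ d) • blockLaw lam Q r v +
        (E' + ∑ k ∈ Finset.range n, hopMeasure lam E' Q r k)) = (α + E') +
        (∑ k ∈ Finset.range n, hopMeasure lam E Q r k +
        ∑ v, (E univ / (n : ℝ≥0∞) ^ d) • blockLaw lam Q r v +
        ∑ k ∈ Finset.range n, hopMeasure lam E' Q r k) by abel, hbal]
    abel
  · rw [hγ, lintegral_add_measure, lintegral_map (by fun_prop) measurable_swap]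
    simp only [Prod.fst_swap, Prod.snd_swap]
    simp_rw [fun z : EuclideanSpace ℝ (Fin d) × EuclideanSpace ℝ (Fin d) => edist_comm z.2 z.1]
    refine (add_le_add (hcost E hE) (hcost E' hE')).trans (le_of_eq ?_)
    ring

end GridTransport

/-! ### Rectangles, their subdivision into cells, and the number of pieces. -/

section Geometry

variable {d n : ℕ}

theorem dist_le_of_forall_abs_sub_le {x y : EuclideanSpace ℝ (Fin d)} {c : ℝ} (hc : 0 ≤ c)
    (h : ∀ i, |x i - y i| ≤ c) : dist x y ≤ d * c := by
  rw [EuclideanSpace.dist_eq]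
  refine Real.sqrt_le_iff.2 ⟨by positivity, ?_⟩
  calc ∑ i, dist (x i) (y i) ^ 2 ≤ ∑ _i : Fin d, c ^ 2 := by
        refine Finset.sum_le_sum fun i _ => ?_
        rw [Real.dist_eq]
        exact pow_le_pow_left₀ (abs_nonneg _) (h i) 2
    _ = d * c ^ 2 := by simp
    _ ≤ (d * c) ^ 2 := by
        rw [mul_pow]
        refine mul_le_mul_of_nonneg_right ?_ (sq_nonneg c)
        exact_mod_cast Nat.le_self_pow two_ne_zero d

theorem rectangle_eq_preimage (x : EuclideanSpace ℝ (Fin d)) (L : Fin d → ℝ) :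
    rectangle x L = WithLp.ofLp ⁻¹' (Set.pi univ fun i => Set.Icc (x i) (x i + L i)) := by
  ext y
  simp only [rectangle, Set.mem_preimage, Set.mem_univ_pi, Set.mem_Icc]
  rfl

theorem measurableSet_rectangle (x : EuclideanSpace ℝ (Fin d)) (L : Fin d → ℝ) :
    MeasurableSet (rectangle x L) := by
  rw [rectangle_eq_preimage]
  exact (PiLp.volume_preserving_ofLp (Fin d)).measurable
    (MeasurableSet.univ_pi fun _ => measurableSet_Icc)

theorem IsModerateRectangle.measurableSet {R : Set (EuclideanSpace ℝ (Fin d))}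
    (hR : IsModerateRectangle R) : MeasurableSet R := by
  obtain ⟨x, L, -, -, rfl⟩ := hR
  exact measurableSet_rectangle x L

theorem volume_rectangle (x : EuclideanSpace ℝ (Fin d)) (L : Fin d → ℝ) :
    volume (rectangle x L) = ∏ i, ENNReal.ofReal (L i) := by
  rw [rectangle_eq_preimage, (PiLp.volume_preserving_ofLp (Fin d)).measure_preimage
    (MeasurableSet.univ_pi fun _ => measurableSet_Icc).nullMeasurableSet, volume_pi_pi]
  simp

/-- The cell with index `u` of the grid with origin `x` and mesh sizes `s`. -/
def gridCell (x : EuclideanSpace ℝ (Fin d)) (s : Fin d → ℝ) (u : Fin d → Fin n) :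
    Set (EuclideanSpace ℝ (Fin d)) :=
  {y | ∀ i, x i + (u i : ℕ) * s i ≤ y i ∧ y i < x i + ((u i : ℕ) + 1) * s i}

variable {x : EuclideanSpace ℝ (Fin d)} {s : Fin d → ℝ}

theorem gridCell_eq_preimage (u : Fin d → Fin n) :
    gridCell x s u = WithLp.ofLp ⁻¹' (Set.pi univ fun i =>
      Set.Ico (x i + (u i : ℕ) * s i) (x i + ((u i : ℕ) + 1) * s i)) := by
  ext y
  simp only [gridCell, Set.mem_preimage, Set.mem_univ_pi, Set.mem_Ico]
  rfl

theorem measurableSet_gridCell (u : Fin d → Fin n) : MeasurableSet (gridCell x s u) := by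
  rw [gridCell_eq_preimage]
  exact (PiLp.volume_preserving_ofLp (Fin d)).measurable
    (MeasurableSet.univ_pi fun _ => measurableSet_Ico)

theorem volume_gridCell (u : Fin d → Fin n) :
    volume (gridCell x s u) = ∏ i, ENNReal.ofReal (s i) := by
  rw [gridCell_eq_preimage, (PiLp.volume_preserving_ofLp (Fin d)).measure_preimage
    (MeasurableSet.univ_pi fun _ => measurableSet_Ico).nullMeasurableSet, volume_pi_pi]
  simp only [Real.volume_Ico]
  refine Finset.prod_congr rfl fun i _ => ?_
  ring_nf

theorem pairwise_disjoint_gridCell (hs : ∀ i, 0 < s i) :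
    Pairwise (Function.onFun Disjoint (gridCell (n := n) x s)) := by
  intro u w huw
  refine Set.disjoint_left.2 fun y hu hw => huw (funext fun i => ?_)
  have h1 := hu i
  have h2 := hw i
  have h3 : ((u i : ℕ) : ℝ) < (w i : ℕ) + 1 := by
    refine lt_of_mul_lt_mul_right (a := s i) ?_ (hs i).le
    linarith
  have h4 : ((w i : ℕ) : ℝ) < (u i : ℕ) + 1 := by
    refine lt_of_mul_lt_mul_right (a := s i) ?_ (hs i).le
    linarith
  have h5 : (u i : ℕ) < w i + 1 := by exact_mod_cast h3
  have h6 : (w i : ℕ) < u i + 1 := by exact_mod_cast h4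
  exact Fin.ext (by omega)

theorem gridCell_subset_rectangle (hs : ∀ i, 0 < s i) (u : Fin d → Fin n) :
    gridCell x s u ⊆ rectangle x fun i => n * s i := by
  intro y hy i
  have h1 := hy i
  have h2 : 0 ≤ ((u i : ℕ) : ℝ) * s i := mul_nonneg (Nat.cast_nonneg _) (hs i).le
  have h3 : (((u i : ℕ) : ℝ) + 1) * s i ≤ n * s i :=
    mul_le_mul_of_nonneg_right (by exact_mod_cast (u i).2) (hs i).le
  constructor <;> linarith

/-- Half-open cells are disjoint but miss upper faces of the rectangle; comparing volumes shows that
the missing set is null. -/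
theorem volume_rectangle_diff_gridCell (hs : ∀ i, 0 < s i) :
    volume (rectangle x (fun i => n * s i) \ ⋃ u : Fin d → Fin n, gridCell x s u) = 0 := by
  have hsub : (⋃ u : Fin d → Fin n, gridCell x s u) ⊆ rectangle x fun i => n * s i :=
    iUnion_subset fun u => gridCell_subset_rectangle hs u
  have hU : volume (⋃ u : Fin d → Fin n, gridCell x s u)
      = volume (rectangle x fun i => n * s i) := by
    rw [measure_iUnion (pairwise_disjoint_gridCell hs) measurableSet_gridCell, tsum_fintype,
      volume_rectangle]
    simp only [volume_gridCell, Finset.sum_const, Finset.card_univ, Fintype.card_fun,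
      Fintype.card_fin, nsmul_eq_mul, Nat.cast_pow]
    simp_rw [ENNReal.ofReal_mul (Nat.cast_nonneg n), Finset.prod_mul_distrib]
    simp
  rw [measure_sdiff hsub (MeasurableSet.iUnion measurableSet_gridCell).nullMeasurableSet, hU,
    tsub_self]
  rw [hU, volume_rectangle]
  exact ENNReal.prod_ne_top fun i _ => ENNReal.ofReal_ne_top

theorem edist_le_of_mem_gridCell (hs : ∀ i, 0 < s i) {b : ℝ} (hb : ∀ i, s i ≤ b) (hb0 : 0 ≤ b)
    {u w : Fin d → Fin n} {k : ℕ} (hw : w ∈ gridBall u k) {y z : EuclideanSpace ℝ (Fin d)}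
    (hy : y ∈ gridCell x s u) (hz : z ∈ gridCell x s w) :
    edist y z ≤ ENNReal.ofReal (d * b) * (k + 1) := by
  have h : dist y z ≤ d * ((k + 1) * b) := by
    refine dist_le_of_forall_abs_sub_le (by positivity) fun i => ?_
    have h1 := hy i
    have h2 := hz i
    have h3 := mem_gridBall.1 hw i
    have h4 : ((u i : ℕ) : ℝ) ≤ (w i : ℕ) + k := by exact_mod_cast h3.1
    have h5 : ((w i : ℕ) : ℝ) ≤ (u i : ℕ) + k := by exact_mod_cast h3.2
    have h6 := mul_le_mul_of_nonneg_right h4 (hs i).le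
    have h7 := mul_le_mul_of_nonneg_right h5 (hs i).le
    have h8 : ((k : ℝ) + 1) * s i ≤ (k + 1) * b := mul_le_mul_of_nonneg_left (hb i) (by positivity)
    rw [abs_le]
    constructor <;> nlinarith
  rw [edist_dist]
  calc ENNReal.ofReal (dist y z) ≤ ENNReal.ofReal (d * b * (k + 1 : ℕ)) := by
        refine ENNReal.ofReal_le_ofReal (h.trans (le_of_eq ?_))
        push_cast; ring
    _ = _ := by
        rw [ENNReal.ofReal_mul (by positivity), ENNReal.ofReal_natCast]
        push_cast; rfl

theorem edist_le_of_mem_rectangle {L : Fin d → ℝ} {b : ℝ} (hb : ∀ i, L i ≤ b) (hb0 : 0 ≤ b)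
    {y z : EuclideanSpace ℝ (Fin d)} (hy : y ∈ rectangle x L) (hz : z ∈ rectangle x L) :
    edist y z ≤ ENNReal.ofReal (d * b) := by
  rw [edist_dist]
  refine ENNReal.ofReal_le_ofReal (dist_le_of_forall_abs_sub_le hb0 fun i => ?_)
  have h1 := hy i
  have h2 := hz i
  have h3 := hb i
  rw [abs_le]
  constructor <;> linarith

theorem IsModerateRectangle.exists_mesh {R : Set (EuclideanSpace ℝ (Fin d))} (hd : 0 < d)
    (hR : IsModerateRectangle R) {n₀ : ℕ} (hn₀ : 0 < n₀)
    (hV : (4 * n₀ : ℝ) ^ d ≤ volume.real R) :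
    ∃ (x : EuclideanSpace ℝ (Fin d)) (s : Fin d → ℝ) (n : ℕ), n₀ ≤ n ∧
      (∀ i, 1 ≤ s i) ∧ (∀ i, s i ≤ 8) ∧ R = rectangle x fun i => n * s i := by
  obtain ⟨x, L, hL, hratio, rfl⟩ := hR
  set ℓ := L ⟨0, hd⟩ with hℓ
  have hℓ0 : 0 < ℓ := hL _
  have h1 : ∀ i, L i ≤ 2 * ℓ := fun i => (div_le_iff₀ hℓ0).1 (hratio i ⟨0, hd⟩)
  have h2 : ∀ i, ℓ ≤ 2 * L i := fun i => (div_le_iff₀ (hL i)).1 (hratio ⟨0, hd⟩ i)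
  have hV2 : volume.real (rectangle x L) ≤ (2 * ℓ) ^ d := by
    rw [measureReal_def, volume_rectangle, ENNReal.toReal_prod]
    calc ∏ i, (ENNReal.ofReal (L i)).toReal ≤ ∏ _i : Fin d, 2 * ℓ := by
          refine Finset.prod_le_prod (fun i _ => ENNReal.toReal_nonneg) fun i _ => ?_
          rw [ENNReal.toReal_ofReal (hL i).le]
          exact h1 i
      _ = (2 * ℓ) ^ d := by simp
  have h3 : (4 * n₀ : ℝ) ≤ 2 * ℓ :=
    (pow_le_pow_iff_left₀ (by positivity) (by positivity) hd.ne').1 (hV.trans hV2)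
  -- All sides lie between `ℓ / 2` and `2 * ℓ`. Dividing by `n ≤ ℓ / 2` gives at least 1, and `ℓ / 2
  -- < n + 1 ≤ 2 * n` gives at most 8.
  set n := ⌊ℓ / 2⌋₊ with hn
  have h4 : n₀ ≤ n := Nat.le_floor (by linarith)
  have hn1 : (1 : ℝ) ≤ n := by exact_mod_cast hn₀.trans_le h4
  have hn0 : (0 : ℝ) < n := by linarith
  have h5 : (n : ℝ) ≤ ℓ / 2 := Nat.floor_le (by positivity)
  have h6 : ℓ / 2 < n + 1 := Nat.lt_floor_add_one _
  refine ⟨x, fun i => L i / n, n, h4, fun i => ?_, fun i => ?_, ?_⟩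
  · rw [le_div_iff₀ hn0]
    have := h2 i
    linarith
  · rw [div_le_iff₀ hn0]
    have := h1 i
    linarith
  · congr 1
    ext i
    field_simp

theorem IsAdmissiblePartition.card_le {N : ℕ} {R : Set (EuclideanSpace ℝ (Fin d))}
    {Ri : Fin N → Set (EuclideanSpace ℝ (Fin d))} (h : IsAdmissiblePartition R Ri)
    (hR : 0 < volume.real R) : N ≤ 3 ^ d := by
  have hV : volume R ≠ ∞ := by
    intro hcon
    simp [measureReal_def, hcon] at hR
  have h1 : volume R = ∑ i, volume (Ri i) := by
    rw [← h.iUnion_eq, measure_iUnion₀ (fun i j hij => h.null_inter i j hij)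
      fun i => (h.moderate i).measurableSet.nullMeasurableSet, tsum_fintype]
  have h2 : ∀ i, volume (Ri i) ≠ ∞ := fun i =>
    ne_top_of_le_ne_top hV (measure_mono (h.iUnion_eq ▸ subset_iUnion Ri i))
  have h3 : volume.real R = ∑ i, volume.real (Ri i) := by
    rw [measureReal_def, h1, ENNReal.toReal_sum fun i _ => h2 i]
    rfl
  have h4 : N * (((3 : ℝ) ^ d)⁻¹ * volume.real R) ≤ volume.real R := by
    conv_rhs => rw [h3]
    calc _ = ∑ _i : Fin N, ((3 : ℝ) ^ d)⁻¹ * volume.real R := by simp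
      _ ≤ _ := Finset.sum_le_sum fun i _ => h.le_volume i
  have h5 : (N : ℝ) * ((3 : ℝ) ^ d)⁻¹ ≤ 1 := by
    refine le_of_mul_le_mul_right ?_ hR
    linarith
  have h6 : (N : ℝ) ≤ 3 ^ d := by
    rw [← div_eq_mul_inv, div_le_one (by positivity)] at h5
    exact h5
  exact_mod_cast h6

end Geometry

/-! ### Deterministic estimates: error measures, weights and elementary inequalities. -/

section Pointwise

variable {d n : ℕ}

/-- The signed difference of the two measures is made nonnegative by adding `η` times `lam` on both
sides: the surplus has densities `κi i - κ + η`, the deficit has density `η`, and both are at most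
`2 * η`. -/
theorem transportCost_sum_smul_restrict_le {p : ℝ} (hp : 0 < p) (hn : 0 < n)
    {lam : Measure (EuclideanSpace ℝ (Fin d))} [IsFiniteMeasure lam]
    {Q : (Fin d → Fin n) → Set (EuclideanSpace ℝ (Fin d))} {r : (Fin d → Fin n) → ℕ}
    (hQm : ∀ u, MeasurableSet (Q u)) (hQd : Pairwise (Function.onFun Disjoint Q))
    (hQ : lam (⋃ u, Q u)ᶜ = 0)
    (hr : ∀ t, 1 ≤ ∑ w ∈ gridBall t (r t), lam (Q w)) {D : ℝ≥0∞}
    (hD : ∀ u w k, w ∈ gridBall u k → ∀ x ∈ Q u, ∀ y ∈ Q w, edist x y ≤ D * (k + 1))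
    {T : ℕ} (hT : ∀ t, r t ≤ T) (hS : ∀ u, lam (Q u) ≤ T)
    {N : ℕ} {S : Fin N → Set (EuclideanSpace ℝ (Fin d))}
    (hlamS : lam = ∑ i, lam.restrict (S i)) {κ η : ℝ} {κi : Fin N → ℝ} (hκ : 0 ≤ κ) (hη : 0 ≤ η)
    (hκη : ∀ i, |κi i - κ| ≤ η) (hκi : ∀ i, 1 / 2 ≤ κi i)
    (hmass : (∑ i, ENNReal.ofReal (κi i) • lam.restrict (S i)) univ
      = (ENNReal.ofReal κ • lam) univ)
    (hcap : 2 * η * (1 + (2 * n + 1) * (T * 2 ^ d * (2 * T + 1) ^ d)) ≤ 1 / 2) :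
    transportCost p (∑ i, ENNReal.ofReal (κi i) • lam.restrict (S i)) (ENNReal.ofReal κ • lam) ≤
      2 * ENNReal.ofReal (2 * η) * (2 * D) ^ p *
      (∑ u, lam (Q u) * ((r u + 1 : ℕ) : ℝ≥0∞) ^ p +
        ((n : ℝ≥0∞) ^ d)⁻¹ * ∑ k ∈ Finset.range n, ∑ z : (Fin d → Fin n) × (Fin d → Fin n),
          lam (Q z.1) * (((r (gridPath z.1 z.2 k) + 1 : ℕ) : ℝ≥0∞) ^ p +
              ((r (gridPath z.1 z.2 (k + 1)) + 1 : ℕ) : ℝ≥0∞) ^ p)) := by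
  set α := ∑ i, ENNReal.ofReal (κi i) • lam.restrict (S i) with hα
  have hβf : IsFiniteMeasure (ENNReal.ofReal κ • lam) := lam.smul_finite ENNReal.ofReal_ne_top
  have hαf : IsFiniteMeasure α := ⟨by rw [hmass]; exact measure_lt_top _ _⟩
  have hE'f : IsFiniteMeasure (ENNReal.ofReal η • lam) := lam.smul_finite ENNReal.ofReal_ne_top
  have hbal : α + ENNReal.ofReal η • lam = ENNReal.ofReal κ • lam
      + ∑ i, ENNReal.ofReal (κi i - κ + η) • lam.restrict (S i) := by
    have h1 : ∀ c : ℝ≥0∞, c • lam = ∑ i, c • lam.restrict (S i) := by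
      intro c
      conv_lhs => rw [hlamS]
      rw [Finset.smul_sum]
    rw [h1, h1, hα, ← Finset.sum_add_distrib, ← Finset.sum_add_distrib]
    refine Finset.sum_congr rfl fun i _ => ?_
    have h2 := abs_le.1 (hκη i)
    have h3 := hκi i
    rw [← add_smul, ← add_smul, ← ENNReal.ofReal_add (by linarith) hη,
      ← ENNReal.ofReal_add hκ (by linarith)]
    congr 2
    ring
  refine transportCost_le_of_grid hp hn (E := ∑ i, ENNReal.ofReal (κi i - κ + η) •
    lam.restrict (S i)) (E' := ENNReal.ofReal η • lam) hQm hQd hQ hr hD hT hS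
    ENNReal.ofReal_ne_top ?_ ?_ hbal ?_ ?_
  · refine Measure.le_iff.2 fun s _ => ?_
    conv_rhs => rw [hlamS]
    rw [Finset.smul_sum, Measure.finsetSum_apply, Measure.finsetSum_apply]
    refine Finset.sum_le_sum fun i _ => ?_
    rw [Measure.smul_apply, Measure.smul_apply, smul_eq_mul, smul_eq_mul]
    gcongr
    have h2 := abs_le.1 (hκη i)
    linarith
  · refine Measure.le_iff.2 fun s _ => ?_
    rw [Measure.smul_apply, Measure.smul_apply, smul_eq_mul, smul_eq_mul]
    gcongr
    linarith
  · have h := congrArg (fun μ : Measure (EuclideanSpace ℝ (Fin d)) => μ univ) hbal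
    simp only [Measure.add_apply] at h
    rw [hmass] at h
    exact ((ENNReal.add_right_inj (measure_ne_top _ _)).1 h).symm
  · have hc : ENNReal.ofReal (2 * η) * (1 + (2 * n + 1) * (T * 2 ^ d *
        ((2 * T + 1 : ℕ) : ℝ≥0∞) ^ d)) ≤ ENNReal.ofReal (1 / 2) := by
      refine le_trans (le_of_eq ?_) (ENNReal.ofReal_le_ofReal hcap)
      rw [ENNReal.ofReal_mul (p := 2 * η) (by positivity)]
      congr 1
      rw [show (1 + (2 * n + 1) * (T * 2 ^ d * (2 * T + 1) ^ d) : ℝ)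
        = ((1 + (2 * n + 1) * (T * 2 ^ d * (2 * T + 1) ^ d) : ℕ) : ℝ) by push_cast; rfl,
        ENNReal.ofReal_natCast]
      push_cast
      rfl
    refine Measure.le_iff.2 fun s _ => ?_
    conv_lhs => rw [hlamS]
    rw [Finset.smul_sum, hα, Measure.finsetSum_apply, Measure.finsetSum_apply]
    refine Finset.sum_le_sum fun i _ => ?_
    rw [Measure.smul_apply, Measure.smul_apply, smul_eq_mul, smul_eq_mul]
    gcongr ?_ * _
    exact hc.trans (ENNReal.ofReal_le_ofReal (hκi i))

/-- The exponential of the number of points in `A`. -/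
noncomputable def countWeight (l : Measure (EuclideanSpace ℝ (Fin d)))
    (A : Set (EuclideanSpace ℝ (Fin d))) : ℝ≥0∞ :=
  ENNReal.ofReal (Real.exp (l A).toReal)

/-- An upper bound for the exponential of half the radius of the largest void ball around `t`. -/
noncomputable def voidWeight (l : Measure (EuclideanSpace ℝ (Fin d)))
    (Q : (Fin d → Fin n) → Set (EuclideanSpace ℝ (Fin d))) (t : Fin d → Fin n) : ℝ≥0∞ :=
  1 + ∑ k ∈ Finset.range n, ENNReal.ofReal (Real.exp ((k + 1) / 2)) *
    ({0} : Set ℝ≥0∞).indicator 1 (∑ w ∈ gridBall t k, l (Q w))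

/-- The distance of the number of points in `A` from its mean, in units of its standard
deviation. -/
noncomputable def deviation (l : Measure (EuclideanSpace ℝ (Fin d)))
    (A : Set (EuclideanSpace ℝ (Fin d))) : ℝ :=
  |(l A).toReal - volume.real A| / √(volume.real A)

/-- The sum of the exponentials of the deviations of two processes on `R` and its pieces. -/
noncomputable def deviationWeight (m l : Measure (EuclideanSpace ℝ (Fin d))) {N : ℕ}
    (R : Set (EuclideanSpace ℝ (Fin d))) (Ri : Fin N → Set (EuclideanSpace ℝ (Fin d))) : ℝ≥0∞ :=
  (ENNReal.ofReal (Real.exp (deviation m R)) + ENNReal.ofReal (Real.exp (deviation l R))) +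
    ∑ i, (ENNReal.ofReal (Real.exp (deviation m (Ri i))) +
      ENNReal.ofReal (Real.exp (deviation l (Ri i))))

theorem exists_deviation_le (m l : Measure (EuclideanSpace ℝ (Fin d))) {N : ℕ}
    (R : Set (EuclideanSpace ℝ (Fin d))) (Ri : Fin N → Set (EuclideanSpace ℝ (Fin d))) :
    ∃ Z : ℝ, deviation m R ≤ Z ∧ deviation l R ≤ Z ∧ (∀ i, deviation m (Ri i) ≤ Z) ∧
      (∀ i, deviation l (Ri i) ≤ Z) ∧
      ENNReal.ofReal (Real.exp Z) ≤ deviationWeight m l R Ri := by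
  -- `none` stands for `R`, and the Boolean selects the process. `Z` is the largest deviation, and
  -- its exponential is one summand of the weight.
  let f : Option (Fin N) × Bool → ℝ := fun a =>
    deviation (if a.2 then m else l) (a.1.elim R Ri)
  obtain ⟨a, -, ha⟩ := Finset.exists_max_image Finset.univ f Finset.univ_nonempty
  refine ⟨f a, ha (none, true) (Finset.mem_univ _), ha (none, false) (Finset.mem_univ _),
    fun i => ha (some i, true) (Finset.mem_univ _),
    fun i => ha (some i, false) (Finset.mem_univ _), ?_⟩
  have hW : deviationWeight m l R Ri = ∑ a, ENNReal.ofReal (Real.exp (f a)) := by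
    rw [Fintype.sum_prod_type, Fintype.sum_option]
    simp [deviationWeight, f]
  rw [hW]
  exact Finset.single_le_sum (f := fun a => ENNReal.ofReal (Real.exp (f a)))
    (fun _ _ => zero_le) (Finset.mem_univ a)

/-- For `r > 0` the summand with `k = r - 1` suffices; the summand 1 of the weight covers `r = 0`.
-/
theorem exp_half_le_voidWeight {l : Measure (EuclideanSpace ℝ (Fin d))}
    {Q : (Fin d → Fin n) → Set (EuclideanSpace ℝ (Fin d))} {t : Fin d → Fin n} {r : ℕ}
    (hrn : r ≤ n) (hr : ∀ k < r, ∑ w ∈ gridBall t k, l (Q w) = 0) :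
    ENNReal.ofReal (Real.exp (r / 2)) ≤ voidWeight l Q t := by
  rw [voidWeight]
  rcases r with _ | k
  · simp
  · refine le_trans ?_ le_add_self
    refine le_trans (le_of_eq ?_) (Finset.single_le_sum (fun _ _ => zero_le)
      (Finset.mem_range.2 (Nat.lt_of_succ_le hrn)))
    rw [hr k (Nat.lt_succ_self k)]
    simp

theorem abs_div_sub_one_le {a b v η : ℝ} (hv : 0 < v) (hη : η ≤ 1 / 2)
    (ha : |a - v| ≤ η * v) (hb : |b - v| ≤ η * v) : |b / a - 1| ≤ 4 * η := by
  rw [abs_le] at ha hb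
  have ha0 : v / 2 ≤ a := by nlinarith
  have ha1 : 0 < a := by linarith
  have hη0 : 0 ≤ η := by
    by_contra! hcon
    nlinarith
  rw [div_sub_one ha1.ne', abs_div, abs_of_pos ha1, div_le_iff₀ ha1, abs_le]
  constructor <;> nlinarith

/-- This decouples the three random factors of the cost, so that no expectation of a product is
needed. -/
theorem mul_mul_le_add_pow_three {a b c : ℝ} (ha : 0 ≤ a) (hb : 0 ≤ b) (hc : 0 ≤ c) :
    a * b * c ≤ a ^ 3 + b ^ 3 + c ^ 3 := by
  have h : 0 ≤ (a + b + c) * ((a - b) ^ 2 + (b - c) ^ 2 + (c - a) ^ 2) := by positivity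
  have : 0 ≤ a * b * c := by positivity
  nlinarith

theorem pow_three_le_exp {a : ℝ} (ha : 0 ≤ a) : a ^ 3 ≤ 6 * Real.exp a := by
  have h := Real.pow_div_factorial_le_exp a ha 3
  rw [div_le_iff₀ (by positivity)] at h
  norm_num [Nat.factorial] at h
  linarith

/-- A constant which bounds the powers of order `3 p` by the exponential of the half. -/
noncomputable def expConst (p : ℝ) : ℝ :=
  (⌈3 * p⌉₊).factorial * 2 ^ ⌈3 * p⌉₊ * Real.exp (1 / 2) + 6

/-- The inequality `x ^ q / q! ≤ exp x` is applied at `x = (r + 1) / 2`; the rate one half is the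
one that `voidWeight` controls. -/
theorem rpow_pow_three_le_exp (p : ℝ) (r : ℕ) :
    (((r + 1 : ℕ) : ℝ) ^ p) ^ 3 ≤ expConst p * Real.exp (r / 2) := by
  set q := ⌈3 * p⌉₊ with hq
  have h1 : (1 : ℝ) ≤ ((r + 1 : ℕ) : ℝ) := by exact_mod_cast Nat.succ_pos r
  have h := Real.pow_div_factorial_le_exp (((r + 1 : ℕ) : ℝ) / 2) (by positivity) q
  rw [div_le_iff₀ (by positivity), div_pow, div_le_iff₀ (by positivity)] at h
  calc (((r + 1 : ℕ) : ℝ) ^ p) ^ 3 = ((r + 1 : ℕ) : ℝ) ^ (3 * p) := by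
        rw [← Real.rpow_natCast, ← Real.rpow_mul (by positivity)]
        congr 1; push_cast; ring
    _ ≤ ((r + 1 : ℕ) : ℝ) ^ (q : ℝ) := Real.rpow_le_rpow_of_exponent_le h1 (Nat.le_ceil _)
    _ = ((r + 1 : ℕ) : ℝ) ^ q := Real.rpow_natCast _ _
    _ ≤ Real.exp (((r + 1 : ℕ) : ℝ) / 2) * q.factorial * 2 ^ q := h
    _ = q.factorial * 2 ^ q * Real.exp (1 / 2) * Real.exp (r / 2) := by
        rw [show ((r + 1 : ℕ) : ℝ) / 2 = 1 / 2 + r / 2 by push_cast; ring, Real.exp_add]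
        ring
    _ ≤ expConst p * Real.exp (r / 2) := by
        refine mul_le_mul_of_nonneg_right ?_ (Real.exp_pos _).le
        rw [expConst]
        linarith

theorem mul_count_mul_rpow_le {Z lu : ℝ} (p : ℝ) (hZ : 0 ≤ Z) (hl : 0 ≤ lu) (r : ℕ) :
    Z * lu * ((r + 1 : ℕ) : ℝ) ^ p ≤
      expConst p * (Real.exp Z + Real.exp lu + Real.exp (r / 2)) := by
  have h6 : 6 ≤ expConst p := by rw [expConst]; linarith [show (0 : ℝ) ≤
    (⌈3 * p⌉₊).factorial * 2 ^ ⌈3 * p⌉₊ * Real.exp (1 / 2) by positivity]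
  have h1 := mul_mul_le_add_pow_three hZ hl (c := ((r + 1 : ℕ) : ℝ) ^ p) (by positivity)
  have h2 := rpow_pow_three_le_exp p r
  have h3 := pow_three_le_exp hZ
  have h4 := pow_three_le_exp hl
  have h5 := mul_le_mul_of_nonneg_right h6 (Real.exp_pos Z).le
  have h7 := mul_le_mul_of_nonneg_right h6 (Real.exp_pos lu).le
  linarith

/-- With `a = exp (T / 4)` this is `a * (1 + Z) ≤ a ^ 2 + (1 + Z) ^ 2` together with `(1 + Z) ^ 2 ≤
2 * exp Z`. It extracts the small factor for the exceptional event. -/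
theorem one_add_le_exp_quarter {T Z : ℝ} (hZ : 0 ≤ Z) :
    1 + Z ≤ Real.exp (-(T / 4)) * (Real.exp (T / 2) + 2 * Real.exp Z) := by
  have h1 := Real.quadratic_le_exp_of_nonneg hZ
  have h2 : (1 + Z) ^ 2 ≤ 2 * Real.exp Z := by nlinarith
  set a := Real.exp (T / 4) with ha
  have ha0 : 0 < a := Real.exp_pos _
  have h3 : Real.exp (T / 2) = a * a := by rw [ha, ← Real.exp_add]; ring_nf
  rw [Real.exp_neg, ← ha, h3, ← div_eq_inv_mul, le_div_iff₀ ha0]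
  nlinarith [sq_nonneg (a - (1 + Z))]

end Pointwise

/-! ### The two measures of the theorem: equal masses and the crude bound. -/

section Combined

variable {d n N : ℕ} {R : Set (EuclideanSpace ℝ (Fin d))}
  {Ri : Fin N → Set (EuclideanSpace ℝ (Fin d))} {m l : Measure (EuclideanSpace ℝ (Fin d))}

theorem massRatio_eq_ofReal {A : Set (EuclideanSpace ℝ (Fin d))} (hm : m A ≠ ∞) (hl : l A ≠ ∞)
    (hpos : 0 < l A) :
    massRatio m l A = ENNReal.ofReal ((m A).toReal / (l A).toReal) := by
  rw [massRatio, ENNReal.ofReal_div_of_pos (ENNReal.toReal_pos hpos.ne' hl),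
    ENNReal.ofReal_toReal hm, ENNReal.ofReal_toReal hl]

theorem restrict_eq_sum_restrict (hU : ⋃ i, Ri i = R) (hRi : ∀ i, MeasurableSet (Ri i))
    (hln : ∀ i j, i ≠ j → l (Ri i ∩ Ri j) = 0) :
    l.restrict R = ∑ i, (l.restrict R).restrict (Ri i) := by
  have hsub : ∀ i, Ri i ⊆ R := fun i => hU ▸ subset_iUnion Ri i
  have h1 : l.restrict R = ∑ i, l.restrict (Ri i) := by
    rw [← hU, Measure.restrict_iUnion_ae (fun i j hij => hln i j hij)
      fun i => (hRi i).nullMeasurableSet, Measure.sum_fintype]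
  conv_lhs => rw [h1]
  refine Finset.sum_congr rfl fun i _ => ?_
  rw [Measure.restrict_restrict (hRi i), inter_eq_left.2 (hsub i)]

theorem transportCostOn_sum_massRatio {p : ℝ} (hU : ⋃ i, Ri i = R) (hR : MeasurableSet R)
    (hRi : ∀ i, MeasurableSet (Ri i)) :
    transportCostOn p R (∑ i, massRatio m l (Ri i) • l.restrict (Ri i)) (massRatio m l R • l) =
      transportCost p (∑ i, massRatio m l (Ri i) • (l.restrict R).restrict (Ri i))
        (massRatio m l R • l.restrict R) := by
  rw [transportCostOn, Measure.restrict_smul]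
  congr 1
  ext s hs
  rw [Measure.restrict_apply hs, Measure.finsetSum_apply, Measure.finsetSum_apply]
  refine Finset.sum_congr rfl fun i _ => ?_
  rw [Measure.smul_apply, Measure.smul_apply, Measure.restrict_apply (hs.inter hR),
    Measure.restrict_restrict (hRi i), Measure.restrict_apply hs,
    inter_eq_left.2 (hU ▸ subset_iUnion Ri i : Ri i ⊆ R), inter_assoc,
    inter_eq_right.2 (hU ▸ subset_iUnion Ri i : Ri i ⊆ R)]

/-- Each piece contributes `κ_i λ(R_i) = μ(R_i)`. With `massRatio_smul_apply_univ`, both measures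
have mass `μ(R)`, as a coupling requires. -/
theorem sum_massRatio_apply_univ (hU : ⋃ i, Ri i = R) (hRi : ∀ i, MeasurableSet (Ri i))
    (hmn : ∀ i j, i ≠ j → m (Ri i ∩ Ri j) = 0) (hl : l R ≠ ∞) (hpos : ∀ i, 0 < l (Ri i)) :
    (∑ i, massRatio m l (Ri i) • (l.restrict R).restrict (Ri i)) univ = m R := by
  have hsub : ∀ i, Ri i ⊆ R := fun i => hU ▸ subset_iUnion Ri i
  rw [Measure.finsetSum_apply]
  conv_rhs => rw [← hU, measure_iUnion₀ (fun i j hij => hmn i j hij)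
      fun i => (hRi i).nullMeasurableSet, tsum_fintype]
  refine Finset.sum_congr rfl fun i _ => ?_
  rw [Measure.smul_apply, smul_eq_mul, Measure.restrict_restrict (hRi i),
    inter_eq_left.2 (hsub i), Measure.restrict_apply_univ, massRatio]
  exact ENNReal.div_mul_cancel (hpos i).ne' (ne_top_of_le_ne_top hl (measure_mono (hsub i)))

theorem massRatio_smul_apply_univ (hl : l R ≠ ∞) (hpos : 0 < l R) :
    (massRatio m l R • l.restrict R) univ = m R := by
  rw [Measure.smul_apply, smul_eq_mul, Measure.restrict_apply_univ, massRatio]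
  exact ENNReal.div_mul_cancel hpos.ne' hl

theorem transportCostOn_sum_massRatio_le_diam {p : ℝ} (hp : 0 < p) (hU : ⋃ i, Ri i = R)
    (hR : MeasurableSet R) (hRi : ∀ i, MeasurableSet (Ri i))
    (hmn : ∀ i j, i ≠ j → m (Ri i ∩ Ri j) = 0) (hm : m R ≠ ∞) (hl : l R ≠ ∞)
    (hpos : ∀ i, 0 < l (Ri i)) (hposR : 0 < l R) {D : ℝ≥0∞}
    (hD : ∀ x ∈ R, ∀ y ∈ R, edist x y ≤ D) :
    transportCostOn p R (∑ i, massRatio m l (Ri i) • l.restrict (Ri i)) (massRatio m l R • l)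
      ≤ D ^ p * m R := by
  rw [transportCostOn_sum_massRatio hU hR hRi]
  have h1 := sum_massRatio_apply_univ hU hRi hmn hl hpos
  have h2 := massRatio_smul_apply_univ (m := m) hl hposR
  have hf : IsFiniteMeasure (∑ i, massRatio m l (Ri i) • (l.restrict R).restrict (Ri i)) :=
    ⟨by rw [h1]; exact hm.lt_top⟩
  have hRc : (l.restrict R) Rᶜ = 0 := by rw [Measure.restrict_apply hR.compl]; simp
  rw [← h1]
  refine transportCost_le_of_edist_le hp ?_ ?_ (h1.trans h2.symm) hD
  · rw [Measure.finsetSum_apply]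
    refine Finset.sum_eq_zero fun i _ => ?_
    rw [Measure.smul_apply, le_antisymm ((Measure.restrict_le_self _).trans hRc.le) zero_le, smul_zero]
  · rw [Measure.smul_apply, hRc, smul_zero]

end Combined

/-! ### The cost on the good event and the mass on the exceptional one. -/

section Combined

variable {d n N : ℕ} {R : Set (EuclideanSpace ℝ (Fin d))}
  {Ri : Fin N → Set (EuclideanSpace ℝ (Fin d))} {m l : Measure (EuclideanSpace ℝ (Fin d))}

/-- The sum of the weights that control the mass which starts at `u` and passes through `t`. -/
noncomputable def localWeight (m l : Measure (EuclideanSpace ℝ (Fin d)))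
    (R : Set (EuclideanSpace ℝ (Fin d))) (Ri : Fin N → Set (EuclideanSpace ℝ (Fin d)))
    (Q : (Fin d → Fin n) → Set (EuclideanSpace ℝ (Fin d))) (u t : Fin d → Fin n) : ℝ≥0∞ :=
  deviationWeight m l R Ri + countWeight l (Q u) + voidWeight l Q t

/-- The sum of the local weights over all paths. -/
noncomputable def pathWeight (m l : Measure (EuclideanSpace ℝ (Fin d)))
    (R : Set (EuclideanSpace ℝ (Fin d))) (Ri : Fin N → Set (EuclideanSpace ℝ (Fin d)))
    (Q : (Fin d → Fin n) → Set (EuclideanSpace ℝ (Fin d))) : ℝ≥0∞ :=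
  ∑ u, localWeight m l R Ri Q u u +
    ((n : ℝ≥0∞) ^ d)⁻¹ * ∑ k ∈ Finset.range n, ∑ z : (Fin d → Fin n) × (Fin d → Fin n),
      (localWeight m l R Ri Q z.1 (gridPath z.1 z.2 k) +
        localWeight m l R Ri Q z.1 (gridPath z.1 z.2 (k + 1)))

/-- The sum of all weights. -/
noncomputable def totalWeight (m l : Measure (EuclideanSpace ℝ (Fin d)))
    (R : Set (EuclideanSpace ℝ (Fin d))) (Ri : Fin N → Set (EuclideanSpace ℝ (Fin d)))
    (Q : (Fin d → Fin n) → Set (EuclideanSpace ℝ (Fin d))) : ℝ≥0∞ :=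
  deviationWeight m l R Ri + ∑ u, countWeight l (Q u) + ∑ t, voidWeight l Q t

/-- As `σ` is at most the square root of the volume, a deviation of `Z` standard deviations is a
relative error of at most `Z / σ`. -/
theorem abs_sub_le_of_deviation_le {A : Set (EuclideanSpace ℝ (Fin d))} {Z σ : ℝ} (hσ : 0 < σ)
    (hA : σ ^ 2 ≤ volume.real A) (hZ : deviation l A ≤ Z) :
    |(l A).toReal - volume.real A| ≤ Z / σ * volume.real A := by
  have hv : 0 < volume.real A := (by positivity : 0 < σ ^ 2).trans_le hA
  have hs : 0 < √(volume.real A) := Real.sqrt_pos.2 hv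
  have hσs : σ ≤ √(volume.real A) := Real.le_sqrt_of_sq_le hA
  have hZ0 : 0 ≤ Z := le_trans (by unfold deviation; positivity) hZ
  rw [deviation, div_le_iff₀ hs] at hZ
  refine hZ.trans ?_
  rw [div_mul_eq_mul_div, le_div_iff₀ hσ, mul_assoc]
  refine mul_le_mul_of_nonneg_left ?_ hZ0
  calc √(volume.real A) * σ ≤ √(volume.real A) * √(volume.real A) := by gcongr
    _ = volume.real A := Real.mul_self_sqrt hv.le

theorem transportCostOn_sum_massRatio_le_pathWeight {p : ℝ} (hp : 0 < p) (hn : 0 < n)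
    {Q : (Fin d → Fin n) → Set (EuclideanSpace ℝ (Fin d))} {r : (Fin d → Fin n) → ℕ}
    (hU : ⋃ i, Ri i = R) (hR : MeasurableSet R) (hRi : ∀ i, MeasurableSet (Ri i))
    (hmn : ∀ i j, i ≠ j → m (Ri i ∩ Ri j) = 0) (hln : ∀ i j, i ≠ j → l (Ri i ∩ Ri j) = 0)
    (hm : m R ≠ ∞) (hl : l R ≠ ∞) (hpos : ∀ i, 0 < l (Ri i)) (hposR : 0 < l R)
    (hQm : ∀ u, MeasurableSet (Q u)) (hQd : Pairwise (Function.onFun Disjoint Q))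
    (hQR : ∀ u, Q u ⊆ R) (hQ : l (R \ ⋃ u, Q u) = 0)
    (hr : ∀ t, 1 ≤ ∑ w ∈ gridBall t (r t), l (Q w)) (hrn : ∀ t, r t ≤ n)
    (hr0 : ∀ t, ∀ k < r t, ∑ w ∈ gridBall t k, l (Q w) = 0) {D : ℝ≥0∞}
    (hD : ∀ u w k, w ∈ gridBall u k → ∀ x ∈ Q u, ∀ y ∈ Q w, edist x y ≤ D * (k + 1))
    {T : ℕ} (hT : ∀ t, r t ≤ T) (hS : ∀ u, l (Q u) ≤ T) {Z σ : ℝ} (hσ : 0 < σ)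
    (hσR : σ ^ 2 ≤ volume.real R) (hσRi : ∀ i, σ ^ 2 ≤ volume.real (Ri i))
    (hZ1 : deviation m R ≤ Z) (hZ2 : deviation l R ≤ Z) (hZ3 : ∀ i, deviation m (Ri i) ≤ Z)
    (hZ4 : ∀ i, deviation l (Ri i) ≤ Z)
    (hZW : ENNReal.ofReal (Real.exp Z) ≤ deviationWeight m l R Ri)
    (hcap : 16 * (Z / σ) * (1 + (2 * n + 1) * (T * 2 ^ d * (2 * T + 1) ^ d)) ≤ 1 / 2) :
    transportCostOn p R (∑ i, massRatio m l (Ri i) • l.restrict (Ri i)) (massRatio m l R • l)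
      ≤ 2 * ENNReal.ofReal (16 / σ) * (2 * D) ^ p * ENNReal.ofReal (expConst p) *
        pathWeight m l R Ri Q := by
  have hZ0 : 0 ≤ Z := le_trans (by unfold deviation; positivity) hZ1
  have hη0 : 0 ≤ Z / σ := by positivity
  have hη : 16 * (Z / σ) ≤ 1 / 2 := by
    refine le_trans ?_ hcap
    refine le_mul_of_one_le_right (by positivity) ?_
    have : (0 : ℝ) ≤ (2 * n + 1) * (T * 2 ^ d * (2 * T + 1) ^ d) := by positivity
    linarith
  have hsub : ∀ i, Ri i ⊆ R := fun i => hU ▸ subset_iUnion Ri i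
  have hmi : ∀ i, m (Ri i) ≠ ∞ := fun i => ne_top_of_le_ne_top hm (measure_mono (hsub i))
  have hli : ∀ i, l (Ri i) ≠ ∞ := fun i => ne_top_of_le_ne_top hl (measure_mono (hsub i))
  have hratio : ∀ A, σ ^ 2 ≤ volume.real A → deviation m A ≤ Z → deviation l A ≤ Z →
      |(m A).toReal / (l A).toReal - 1| ≤ 4 * (Z / σ) := fun A hA h1 h2 =>
    abs_div_sub_one_le ((by positivity : 0 < σ ^ 2).trans_le hA) (by linarith)
      (abs_sub_le_of_deviation_le hσ hA h2) (abs_sub_le_of_deviation_le hσ hA h1)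
  have hlf : IsFiniteMeasure (l.restrict R) :=
    ⟨by rw [Measure.restrict_apply_univ]; exact hl.lt_top⟩
  have hlQ : ∀ u, (l.restrict R) (Q u) = l (Q u) := fun u => by
    rw [Measure.restrict_apply (hQm u), inter_eq_left.2 (hQR u)]
  have hmass := (sum_massRatio_apply_univ hU hRi hmn hl hpos).trans
    (massRatio_smul_apply_univ (m := m) hl hposR).symm
  rw [transportCostOn_sum_massRatio hU hR hRi]
  simp_rw [fun i => massRatio_eq_ofReal (hmi i) (hli i) (hpos i),
    massRatio_eq_ofReal hm hl hposR] at hmass ⊢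
  have hmain := transportCost_sum_smul_restrict_le hp hn (lam := l.restrict R) (S := Ri)
    (κ := (m R).toReal / (l R).toReal) (κi := fun i => (m (Ri i)).toReal / (l (Ri i)).toReal)
    -- Every ratio is within `4 * (Z / σ)` of 1, so two ratios differ by at most twice that.
    (η := 8 * (Z / σ)) hQm hQd
    (by rw [Measure.restrict_apply (MeasurableSet.iUnion hQm).compl, inter_comm]; exact hQ)
    (by simpa only [hlQ] using hr) hD hT (by simpa only [hlQ] using hS)
    (restrict_eq_sum_restrict hU hRi hln) (by positivity) (by positivity)
    (fun i => by
      have h1 := abs_le.1 (hratio (Ri i) (hσRi i) (hZ3 i) (hZ4 i))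
      have h2 := abs_le.1 (hratio R hσR hZ1 hZ2)
      rw [abs_le]
      constructor <;> linarith)
    (fun i => by
      have h1 := abs_le.1 (hratio (Ri i) (hσRi i) (hZ3 i) (hZ4 i))
      linarith) hmass
    (by rw [show 2 * (8 * (Z / σ)) = 16 * (Z / σ) by ring]; exact hcap)
  refine hmain.trans ?_
  simp only [hlQ]
  have hloc : ∀ u t, ENNReal.ofReal Z * (l (Q u) * ((r t + 1 : ℕ) : ℝ≥0∞) ^ p) ≤
      ENNReal.ofReal (expConst p) * localWeight m l R Ri Q u t := by
    intro u t
    have hlu : l (Q u) ≠ ∞ := ne_top_of_le_ne_top hl (measure_mono (hQR u))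
    have h1 : ((r t + 1 : ℕ) : ℝ≥0∞) ^ p = ENNReal.ofReal (((r t + 1 : ℕ) : ℝ) ^ p) := by
      rw [← ENNReal.ofReal_rpow_of_nonneg (by positivity) hp.le, ENNReal.ofReal_natCast]
    have hc : 0 ≤ expConst p := by unfold expConst; positivity
    rw [h1, ← ENNReal.ofReal_toReal hlu, ← mul_assoc, ← ENNReal.ofReal_mul hZ0,
      ← ENNReal.ofReal_mul (by positivity)]
    refine (ENNReal.ofReal_le_ofReal
      (mul_count_mul_rpow_le p hZ0 ENNReal.toReal_nonneg (r t))).trans ?_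
    rw [ENNReal.ofReal_mul hc, ENNReal.ofReal_add (by positivity) (by positivity),
      ENNReal.ofReal_add (by positivity) (by positivity), localWeight]
    gcongr
    · exact le_rfl
    · exact exp_half_le_voidWeight (hrn t) (hr0 t)
  -- The factor `Z` is moved from the prefactor into each summand, where `hloc` absorbs it; the
  -- deterministic `16 / σ` stays outside.
  have h16 : ENNReal.ofReal (2 * (8 * (Z / σ)))
      = ENNReal.ofReal (16 / σ) * ENNReal.ofReal Z := by
    rw [← ENNReal.ofReal_mul (by positivity)]
    congr 1; ring
  rw [h16]
  calc _ = 2 * ENNReal.ofReal (16 / σ) * (2 * D) ^ p *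
        (∑ u, ENNReal.ofReal Z * (l (Q u) * ((r u + 1 : ℕ) : ℝ≥0∞) ^ p) +
        ((n : ℝ≥0∞) ^ d)⁻¹ * ∑ k ∈ Finset.range n, ∑ z : (Fin d → Fin n) × (Fin d → Fin n),
          (ENNReal.ofReal Z * (l (Q z.1) * ((r (gridPath z.1 z.2 k) + 1 : ℕ) : ℝ≥0∞) ^ p) +
            ENNReal.ofReal Z *
              (l (Q z.1) * ((r (gridPath z.1 z.2 (k + 1)) + 1 : ℕ) : ℝ≥0∞) ^ p))) := by
        simp only [← mul_add, ← Finset.mul_sum]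
        ring
    _ ≤ 2 * ENNReal.ofReal (16 / σ) * (2 * D) ^ p *
        (∑ u, ENNReal.ofReal (expConst p) * localWeight m l R Ri Q u u +
        ((n : ℝ≥0∞) ^ d)⁻¹ * ∑ k ∈ Finset.range n, ∑ z : (Fin d → Fin n) × (Fin d → Fin n),
          (ENNReal.ofReal (expConst p) * localWeight m l R Ri Q z.1 (gridPath z.1 z.2 k) +
            ENNReal.ofReal (expConst p) *
              localWeight m l R Ri Q z.1 (gridPath z.1 z.2 (k + 1)))) := by
        exact mul_le_mul_right (add_le_add (Finset.sum_le_sum fun u _ => hloc _ _)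
          (mul_le_mul_right (Finset.sum_le_sum fun k _ => Finset.sum_le_sum fun z _ =>
            add_le_add (hloc _ _) (hloc _ _)) _)) _
    _ = _ := by
        rw [pathWeight]
        simp only [← mul_add, ← Finset.mul_sum]
        ring

/-- On the exceptional event where some weight is large, the total mass is dominated by a small
multiple of the total weight. -/
theorem measure_le_totalWeight
    {Q : (Fin d → Fin n) → Set (EuclideanSpace ℝ (Fin d))} {r : (Fin d → Fin n) → ℕ}
    (hV : 1 ≤ volume.real R) (hm : m R ≠ ∞) (hQf : ∀ u, l (Q u) ≠ ∞) (hrn : ∀ t, r t ≤ n)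
    (hr0 : ∀ t, ∀ k < r t, ∑ w ∈ gridBall t k, l (Q w) = 0) {T : ℕ} {Z : ℝ}
    (hZ1 : deviation m R ≤ Z) (hZW : ENNReal.ofReal (Real.exp Z) ≤ deviationWeight m l R Ri)
    (hbad : ¬ (Z ≤ T ∧ (∀ t, r t ≤ T) ∧ ∀ u, l (Q u) ≤ T)) :
    m R ≤ ENNReal.ofReal (volume.real R) *
      (ENNReal.ofReal (Real.exp (-(T / 4))) * (3 * totalWeight m l R Ri Q)) := by
  have hZ0 : 0 ≤ Z := le_trans (by unfold deviation; positivity) hZ1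
  have hWtot : deviationWeight m l R Ri ≤ totalWeight m l R Ri Q :=
    le_self_add.trans le_self_add
  -- Whichever of the three bounds fails, one weight is at least `exp (T / 2)`; the void weight,
  -- with its rate one half, determines the exponent.
  have hlarge : ENNReal.ofReal (Real.exp (T / 2)) ≤ totalWeight m l R Ri Q := by
    have hT2 : (T : ℝ) / 2 ≤ T := by
      have : (0 : ℝ) ≤ T := Nat.cast_nonneg T
      linarith
    by_cases h1 : Z ≤ T
    · by_cases h2 : ∀ t, r t ≤ T
      · have h3 : ¬ ∀ u, l (Q u) ≤ T := fun h3 => hbad ⟨h1, h2, h3⟩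
        push Not at h3
        obtain ⟨u, hu⟩ := h3
        have hT3 : (T : ℝ) ≤ (l (Q u)).toReal := by
          have := ENNReal.toReal_mono (hQf u) hu.le
          simpa using this
        refine le_trans ?_ (le_trans (Finset.single_le_sum (f := fun u => countWeight l (Q u))
          (fun _ _ => zero_le) (Finset.mem_univ u)) (le_add_self.trans le_self_add))
        exact ENNReal.ofReal_le_ofReal (Real.exp_le_exp.2 (hT2.trans hT3))
      · push Not at h2
        obtain ⟨t, ht⟩ := h2
        refine le_trans ?_ (le_trans (Finset.single_le_sum (f := fun t => voidWeight l Q t)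
          (fun _ _ => zero_le) (Finset.mem_univ t)) le_add_self)
        refine le_trans (ENNReal.ofReal_le_ofReal (Real.exp_le_exp.2 ?_))
          (exp_half_le_voidWeight (hrn t) (hr0 t))
        have : (T : ℝ) ≤ r t := by exact_mod_cast ht.le
        linarith
    · refine le_trans (ENNReal.ofReal_le_ofReal (Real.exp_le_exp.2 ?_)) (hZW.trans hWtot)
      linarith [not_le.1 h1]
  have hmass : (m R).toReal ≤ volume.real R * (1 + Z) := by
    have h := abs_le.1 (abs_sub_le_of_deviation_le (σ := 1) one_pos (by simpa using hV) hZ1)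
    rw [div_one] at h
    linarith
  calc m R = ENNReal.ofReal (m R).toReal := (ENNReal.ofReal_toReal hm).symm
    _ ≤ ENNReal.ofReal (volume.real R * (Real.exp (-(T / 4)) *
        (Real.exp (T / 2) + 2 * Real.exp Z))) := by
        refine ENNReal.ofReal_le_ofReal (hmass.trans ?_)
        exact mul_le_mul_of_nonneg_left (one_add_le_exp_quarter hZ0) (by linarith)
    _ = ENNReal.ofReal (volume.real R) * (ENNReal.ofReal (Real.exp (-(T / 4))) *
        (ENNReal.ofReal (Real.exp (T / 2)) + 2 * ENNReal.ofReal (Real.exp Z))) := by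
        rw [ENNReal.ofReal_mul (by linarith), ENNReal.ofReal_mul (by positivity),
          ENNReal.ofReal_add (by positivity) (by positivity), ENNReal.ofReal_mul (by norm_num)]
        simp
    _ ≤ _ := by
        gcongr
        calc _ ≤ totalWeight m l R Ri Q + 2 * totalWeight m l R Ri Q := by
              gcongr
              exact hZW.trans hWtot
          _ = _ := by ring

end Combined

/-! ### The pointwise bound for a single realization. -/

section Combined

variable {d n N : ℕ}

/-- The radius is the least one whose ball contains a point; radius `n` works, as that ball is the
whole grid. -/
theorem exists_void_radius {Q : (Fin d → Fin n) → Set (EuclideanSpace ℝ (Fin d))}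
    {l : Measure (EuclideanSpace ℝ (Fin d))} (hat : ∀ u, 0 < l (Q u) → 1 ≤ l (Q u))
    (hpos : 0 < ∑ u, l (Q u)) (t : Fin d → Fin n) :
    ∃ r ≤ n, 1 ≤ ∑ w ∈ gridBall t r, l (Q w) ∧ ∀ k < r, ∑ w ∈ gridBall t k, l (Q w) = 0 := by
  classical
  have hex : ∃ k, ∑ w ∈ gridBall t k, l (Q w) ≠ 0 := ⟨n, by
    rw [gridBall_size]; exact hpos.ne'⟩
  refine ⟨Nat.find hex, Nat.find_min' hex (by rw [gridBall_size]; exact hpos.ne'), ?_,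
    fun k hk => not_not.1 (Nat.find_min hex hk)⟩
  obtain ⟨w, hw, hw0⟩ := Finset.exists_ne_zero_of_sum_ne_zero (Nat.find_spec hex)
  exact (hat w (pos_iff_ne_zero.2 hw0)).trans
    (Finset.single_le_sum (f := fun w => l (Q w)) (fun _ _ => zero_le) hw)

theorem pow_le_volume_rectangle {x : EuclideanSpace ℝ (Fin d)} {s : Fin d → ℝ}
    (hs1 : ∀ i, 1 ≤ s i) : (n : ℝ) ^ d ≤ volume.real (rectangle x fun i => n * s i) := by
  rw [measureReal_def, volume_rectangle, ENNReal.toReal_prod]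
  calc (n : ℝ) ^ d = ∏ _i : Fin d, (n : ℝ) := by simp
    _ ≤ _ := by
      refine Finset.prod_le_prod (fun i _ => Nat.cast_nonneg n) fun i _ => ?_
      have h := mul_le_mul_of_nonneg_left (hs1 i) (Nat.cast_nonneg (α := ℝ) n)
      rw [ENNReal.toReal_ofReal (le_trans (by positivity) h)]
      linarith

theorem volume_rectangle_le_pow {x : EuclideanSpace ℝ (Fin d)} {s : Fin d → ℝ}
    (hs1 : ∀ i, 1 ≤ s i) (hs8 : ∀ i, s i ≤ 8) :
    volume.real (rectangle x fun i => n * s i) ≤ (8 * n : ℝ) ^ d := by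
  rw [measureReal_def, volume_rectangle, ENNReal.toReal_prod]
  calc _ ≤ ∏ _i : Fin d, (8 * n : ℝ) := by
        refine Finset.prod_le_prod (fun i _ => ENNReal.toReal_nonneg) fun i _ => ?_
        have h := mul_le_mul_of_nonneg_left (hs8 i) (Nat.cast_nonneg (α := ℝ) n)
        rw [ENNReal.toReal_ofReal (mul_nonneg (Nat.cast_nonneg n)
          (zero_le_one.trans (hs1 i)))]
        linarith
    _ = _ := by simp

theorem volume_rectangle_ne_top (x : EuclideanSpace ℝ (Fin d)) (L : Fin d → ℝ) :
    volume (rectangle x L) ≠ ∞ := by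
  rw [volume_rectangle]
  exact ENNReal.prod_ne_top fun i _ => ENNReal.ofReal_ne_top

/-- One of the two summands suffices, depending on the realization. Since their sum is a bound in
all cases, the measurability of the radii, of `Z` and of the good event never matters. -/
theorem inv_volume_mul_transportCostOn_le {p : ℝ} (hp : 0 < p) (hn : 0 < n)
    {R : Set (EuclideanSpace ℝ (Fin d))} {Ri : Fin N → Set (EuclideanSpace ℝ (Fin d))}
    {m l : Measure (EuclideanSpace ℝ (Fin d))}
    {x : EuclideanSpace ℝ (Fin d)} {s : Fin d → ℝ} (hs1 : ∀ i, 1 ≤ s i) (hs8 : ∀ i, s i ≤ 8)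
    (hRs : R = rectangle x fun i => n * s i) (hpart : IsAdmissiblePartition R Ri)
    (hmn : ∀ i j, i ≠ j → m (Ri i ∩ Ri j) = 0) (hln : ∀ i j, i ≠ j → l (Ri i ∩ Ri j) = 0)
    (hm : m R ≠ ∞) (hl : l R ≠ ∞) (hpos : ∀ i, 0 < l (Ri i))
    (hQ : l (R \ ⋃ u : Fin d → Fin n, gridCell x s u) = 0)
    (hat : ∀ u : Fin d → Fin n, 0 < l (gridCell x s u) → 1 ≤ l (gridCell x s u))
    {T : ℕ} {σ : ℝ} (hσ : 0 < σ) (hσn : σ ^ 2 = ((3 : ℝ) ^ d)⁻¹ * (n : ℝ) ^ d)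
    (hcap : 16 * (T / σ) * (1 + (2 * n + 1) * (T * 2 ^ d * (2 * T + 1) ^ d)) ≤ 1 / 2) :
    (volume R)⁻¹ * transportCostOn p R (∑ i, massRatio m l (Ri i) • l.restrict (Ri i))
        (massRatio m l R • l) ≤
      ((n : ℝ≥0∞) ^ d)⁻¹ * (2 * ENNReal.ofReal (16 / σ) * (2 * ENNReal.ofReal (d * 8)) ^ p *
        ENNReal.ofReal (expConst p) *
          pathWeight m l R Ri (fun u : Fin d → Fin n => gridCell x s u)) +
      ENNReal.ofReal (d * (8 * n)) ^ p * (ENNReal.ofReal (Real.exp (-(T / 4))) *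
        (3 * totalWeight m l R Ri (fun u : Fin d → Fin n => gridCell x s u))) := by
  have hs0 : ∀ i, 0 < s i := fun i => zero_lt_one.trans_le (hs1 i)
  have hU := hpart.iUnion_eq
  have hRm : MeasurableSet R := hRs ▸ measurableSet_rectangle x _
  have hRi := fun i => (hpart.moderate i).measurableSet
  have hsub : ∀ i, Ri i ⊆ R := fun i => hU ▸ subset_iUnion Ri i
  have hn1 : (1 : ℝ) ≤ n := by exact_mod_cast hn
  have hVn : (n : ℝ) ^ d ≤ volume.real R := hRs ▸ pow_le_volume_rectangle hs1
  have hV1 : 1 ≤ volume.real R := (one_le_pow₀ hn1).trans hVn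
  have hVtop : volume R ≠ ∞ := hRs ▸ volume_rectangle_ne_top x _
  have hVeq : volume R = ENNReal.ofReal (volume.real R) := (ENNReal.ofReal_toReal hVtop).symm
  have hσR : σ ^ 2 ≤ volume.real R := by
    rw [hσn]
    refine le_trans (mul_le_of_le_one_left (by positivity) ?_) hVn
    exact inv_le_one_of_one_le₀ (one_le_pow₀ (by norm_num))
  have hσRi : ∀ i, σ ^ 2 ≤ volume.real (Ri i) := fun i => by
    refine le_trans ?_ (hpart.le_volume i)
    rw [hσn]
    gcongr
  have hposR : 0 < l R := by
    have hne : R.Nonempty := by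
      rw [Set.nonempty_iff_ne_empty]
      rintro h
      rw [h] at hV1
      simp at hV1
      linarith
    rw [← hU] at hne
    obtain ⟨y, hy⟩ := hne
    obtain ⟨i, -⟩ := mem_iUnion.1 hy
    exact (hpos i).trans_le (measure_mono (hsub i))
  have hQR : ∀ u : Fin d → Fin n, gridCell x s u ⊆ R := fun u =>
    hRs ▸ gridCell_subset_rectangle hs0 u
  have hsum : 0 < ∑ u : Fin d → Fin n, l (gridCell x s u) := by
    refine hposR.trans_le ?_
    calc l R ≤ l ((R \ ⋃ u : Fin d → Fin n, gridCell x s u) ∪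
          ⋃ u : Fin d → Fin n, gridCell x s u) := measure_mono (by
            rw [Set.sdiff_union_self]; exact subset_union_left)
      _ ≤ l (R \ ⋃ u : Fin d → Fin n, gridCell x s u) +
          l (⋃ u : Fin d → Fin n, gridCell x s u) := measure_union_le _ _
      _ ≤ _ := by rw [hQ, zero_add]; exact measure_iUnion_fintype_le _ _
  choose r hrn hr hr0 using exists_void_radius hat hsum
  obtain ⟨Z, hZ1, hZ2, hZ3, hZ4, hZW⟩ := exists_deviation_le m l R Ri
  have hD : ∀ (u w : Fin d → Fin n) (k : ℕ), w ∈ gridBall u k → ∀ y ∈ gridCell x s u,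
      ∀ z ∈ gridCell x s w, edist y z ≤ ENNReal.ofReal (d * 8) * (k + 1) :=
    fun u w k hw y hy z hz => edist_le_of_mem_gridCell hs0 hs8 (by norm_num) hw hy hz
  by_cases hgood : Z ≤ T ∧ (∀ t, r t ≤ T) ∧ ∀ u : Fin d → Fin n, l (gridCell x s u) ≤ T
  · refine le_trans ?_ le_self_add
    obtain ⟨hZT, hrT, hlT⟩ := hgood
    have hcap' : 16 * (Z / σ) * (1 + (2 * n + 1) * (T * 2 ^ d * (2 * T + 1) ^ d)) ≤ 1 / 2 := by
      refine le_trans ?_ hcap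
      gcongr
    refine mul_le_mul' ?_ (transportCostOn_sum_massRatio_le_pathWeight hp hn hU hRm hRi hmn hln
      hm hl hpos hposR measurableSet_gridCell (pairwise_disjoint_gridCell hs0) hQR hQ hr hrn hr0
      hD hrT hlT hσ hσR hσRi hZ1 hZ2 hZ3 hZ4 hZW hcap')
    rw [ENNReal.inv_le_inv, hVeq]
    refine le_trans (le_of_eq ?_) (ENNReal.ofReal_le_ofReal hVn)
    rw [ENNReal.ofReal_pow (Nat.cast_nonneg n), ENNReal.ofReal_natCast]
  · refine le_trans ?_ le_add_self
    have hDR : ∀ y ∈ R, ∀ z ∈ R, edist y z ≤ ENNReal.ofReal (d * (8 * n)) := by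
      rw [hRs]
      intro y hy z hz
      refine edist_le_of_mem_rectangle (fun i => ?_) (by positivity) hy hz
      rw [mul_comm]
      exact mul_le_mul_of_nonneg_right (hs8 i) (Nat.cast_nonneg n)
    have h1 := transportCostOn_sum_massRatio_le_diam hp hU hRm hRi hmn hm hl hpos hposR hDR
    have h2 := measure_le_totalWeight (Ri := Ri) hV1 hm
      (fun u => ne_top_of_le_ne_top hl (measure_mono (hQR u))) hrn hr0 hZ1 hZW hgood
    have hV0 : volume R ≠ 0 := by
      rw [hVeq]
      exact (ENNReal.ofReal_pos.2 (by linarith)).ne'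
    calc _ ≤ (volume R)⁻¹ * (ENNReal.ofReal (d * (8 * n)) ^ p *
          (volume R * (ENNReal.ofReal (Real.exp (-(T / 4))) *
          (3 * totalWeight m l R Ri (fun u : Fin d → Fin n => gridCell x s u))))) := by
          gcongr
          refine h1.trans ?_
          gcongr
          exact h2.trans (le_of_eq (by rw [← hVeq]))
      _ = _ := by
          rw [mul_left_comm, ← mul_assoc (volume R)⁻¹, ENNReal.inv_mul_cancel hV0 hVtop, one_mul]

end Combined

/-! ### Measurability and expectations of the weights. -/

section Expectation

variable {d n N : ℕ} {Ω : Type*} [MeasurableSpace Ω] {P : Measure Ω}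
  {μ lam : Ω → Measure (EuclideanSpace ℝ (Fin d))} {R : Set (EuclideanSpace ℝ (Fin d))}
  {Ri : Fin N → Set (EuclideanSpace ℝ (Fin d))}
  {Q : (Fin d → Fin n) → Set (EuclideanSpace ℝ (Fin d))}

theorem measurable_countWeight (h : IsPoissonProcess P lam) {A : Set (EuclideanSpace ℝ (Fin d))}
    (hA : MeasurableSet A) : Measurable fun ω => countWeight (lam ω) A := by
  have := h.measurable_apply hA
  unfold countWeight
  fun_prop

theorem measurable_exp_deviation (h : IsPoissonProcess P lam)
    {A : Set (EuclideanSpace ℝ (Fin d))} (hA : MeasurableSet A) :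
    Measurable fun ω => ENNReal.ofReal (Real.exp (deviation (lam ω) A)) := by
  have := h.measurable_apply hA
  have h2 : Measurable fun ω => |((lam ω) A).toReal - volume.real A| :=
    ((this.ennreal_toReal).sub_const _).norm
  unfold deviation
  fun_prop

theorem measurable_deviationWeight (hμ : IsPoissonProcess P μ) (hlam : IsPoissonProcess P lam)
    (hR : MeasurableSet R) (hRi : ∀ i, MeasurableSet (Ri i)) :
    Measurable fun ω => deviationWeight (μ ω) (lam ω) R Ri :=
  ((measurable_exp_deviation hμ hR).fun_add (measurable_exp_deviation hlam hR)).add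
    (Finset.measurable_fun_sum _ fun i _ =>
      (measurable_exp_deviation hμ (hRi i)).fun_add (measurable_exp_deviation hlam (hRi i)))

theorem measurable_voidWeight (h : IsPoissonProcess P lam) (hQm : ∀ u, MeasurableSet (Q u))
    (t : Fin d → Fin n) : Measurable fun ω => voidWeight (lam ω) Q t := by
  refine (measurable_const (a := (1 : ℝ≥0∞))).fun_add (Finset.measurable_fun_sum _ fun k _ => ?_)
  refine Measurable.const_mul ?_ _
  exact (measurable_one.indicator (measurableSet_singleton 0)).comp
    (Finset.measurable_fun_sum _ fun w _ => h.measurable_apply (hQm w))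

theorem measurable_localWeight (hμ : IsPoissonProcess P μ) (hlam : IsPoissonProcess P lam)
    (hR : MeasurableSet R) (hRi : ∀ i, MeasurableSet (Ri i)) (hQm : ∀ u, MeasurableSet (Q u))
    (u t : Fin d → Fin n) : Measurable fun ω => localWeight (μ ω) (lam ω) R Ri Q u t :=
  ((measurable_deviationWeight hμ hlam hR hRi).fun_add (measurable_countWeight hlam (hQm u))).add
    (measurable_voidWeight hlam hQm t)

theorem measurable_pathWeight (hμ : IsPoissonProcess P μ) (hlam : IsPoissonProcess P lam)
    (hR : MeasurableSet R) (hRi : ∀ i, MeasurableSet (Ri i)) (hQm : ∀ u, MeasurableSet (Q u)) :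
    Measurable fun ω => pathWeight (μ ω) (lam ω) R Ri Q := by
  have h := measurable_localWeight hμ hlam hR hRi hQm
  exact (Finset.measurable_fun_sum _ fun u _ => h u u).fun_add (Measurable.const_mul
    (Finset.measurable_fun_sum _ fun k _ => Finset.measurable_fun_sum _ fun z _ =>
      (h _ _).fun_add (h _ _)) _)

theorem measurable_totalWeight (hμ : IsPoissonProcess P μ) (hlam : IsPoissonProcess P lam)
    (hR : MeasurableSet R) (hRi : ∀ i, MeasurableSet (Ri i)) (hQm : ∀ u, MeasurableSet (Q u)) :
    Measurable fun ω => totalWeight (μ ω) (lam ω) R Ri Q :=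
  ((measurable_deviationWeight hμ hlam hR hRi).fun_add (Finset.measurable_fun_sum _ fun u _ =>
    measurable_countWeight hlam (hQm u))).add
    (Finset.measurable_fun_sum _ fun t _ => measurable_voidWeight hlam hQm t)

/-- A bound for the expectations of the local weights. -/
noncomputable def weightConst (d : ℕ) : ℝ≥0∞ :=
  (2 + 2 * 3 ^ d) * ENNReal.ofReal (2 * Real.exp 1) +
    ENNReal.ofReal (Real.exp (8 ^ d * (Real.exp 1 - 1))) +
    (1 + (1 - ENNReal.ofReal (Real.exp (-(1 / 2))))⁻¹)

theorem weightConst_ne_top (d : ℕ) : weightConst d ≠ ∞ := by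
  have h : ENNReal.ofReal (Real.exp (-(1 / 2))) < 1 := by
    rw [ENNReal.ofReal_lt_one]
    exact Real.exp_lt_one_iff.2 (by norm_num)
  have h2 : (1 - ENNReal.ofReal (Real.exp (-(1 / 2))))⁻¹ ≠ ∞ :=
    ENNReal.inv_ne_top.2 (tsub_pos_of_lt h).ne'
  have h3 : (2 + 2 * 3 ^ d : ℝ≥0∞) ≠ ∞ := by
    have : (2 + 2 * 3 ^ d : ℝ≥0∞) = ((2 + 2 * 3 ^ d : ℕ) : ℝ≥0∞) := by push_cast; rfl
    rw [this]; exact ENNReal.natCast_ne_top _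
  unfold weightConst
  finiteness

theorem lintegral_deviationWeight_le (hμ : IsPoissonProcess P μ) (hlam : IsPoissonProcess P lam)
    (hR : MeasurableSet R) (hRi : ∀ i, MeasurableSet (Ri i)) (hRv : 1 ≤ volume.real R)
    (hRiv : ∀ i, 1 ≤ volume.real (Ri i)) (hN : N ≤ 3 ^ d) :
    ∫⁻ ω, deviationWeight (μ ω) (lam ω) R Ri ∂P
      ≤ (2 + 2 * 3 ^ d) * ENNReal.ofReal (2 * Real.exp 1) := by
  have htop : ∀ A : Set (EuclideanSpace ℝ (Fin d)), 1 ≤ volume.real A → volume A ≠ ∞ := by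
    intro A hA hcon
    rw [measureReal_def, hcon] at hA
    simp at hA
    linarith
  have hone : ∀ (ν : Ω → Measure (EuclideanSpace ℝ (Fin d))), IsPoissonProcess P ν →
      ∀ A, MeasurableSet A → 1 ≤ volume.real A →
      ∫⁻ ω, ENNReal.ofReal (Real.exp (deviation (ν ω) A)) ∂P ≤ ENNReal.ofReal (2 * Real.exp 1) :=
    fun ν hν A hA hv => hν.lintegral_exp_abs_sub_le hA (htop A hv) hv
  have htwo : ∀ A, MeasurableSet A → 1 ≤ volume.real A →
      ∫⁻ ω, (ENNReal.ofReal (Real.exp (deviation (μ ω) A)) +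
        ENNReal.ofReal (Real.exp (deviation (lam ω) A))) ∂P
      ≤ 2 * ENNReal.ofReal (2 * Real.exp 1) := by
    intro A hA hv
    rw [lintegral_add_left (measurable_exp_deviation hμ hA), two_mul]
    exact add_le_add (hone μ hμ A hA hv) (hone lam hlam A hA hv)
  unfold deviationWeight
  rw [lintegral_add_left ((measurable_exp_deviation hμ hR).fun_add (measurable_exp_deviation hlam hR)),
    lintegral_finsetSum _ fun i _ =>
      (measurable_exp_deviation hμ (hRi i)).fun_add (measurable_exp_deviation hlam (hRi i))]
  calc _ ≤ 2 * ENNReal.ofReal (2 * Real.exp 1)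
        + ∑ _i : Fin N, 2 * ENNReal.ofReal (2 * Real.exp 1) :=
        add_le_add (htwo R hR hRv) (Finset.sum_le_sum fun i _ => htwo _ (hRi i) (hRiv i))
    _ = 2 * ENNReal.ofReal (2 * Real.exp 1) + N * (2 * ENNReal.ofReal (2 * Real.exp 1)) := by
        simp
    _ ≤ 2 * ENNReal.ofReal (2 * Real.exp 1)
        + (3 ^ d : ℕ) * (2 * ENNReal.ofReal (2 * Real.exp 1)) := by
        gcongr
    _ = _ := by push_cast; ring

theorem lintegral_countWeight_le (hlam : IsPoissonProcess P lam)
    {A : Set (EuclideanSpace ℝ (Fin d))} (hA : MeasurableSet A) (hA' : volume A ≠ ∞)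
    (hv : volume.real A ≤ 8 ^ d) :
    ∫⁻ ω, countWeight (lam ω) A ∂P ≤ ENNReal.ofReal (Real.exp (8 ^ d * (Real.exp 1 - 1))) := by
  have h := hlam.lintegral_exp hA hA' 1
  simp only [one_mul] at h
  unfold countWeight
  rw [h]
  refine ENNReal.ofReal_le_ofReal (Real.exp_le_exp.2 (mul_le_mul_of_nonneg_right hv ?_))
  have := Real.add_one_le_exp 1
  linarith

/-- A ball of radius `k < n` has volume at least `k + 1` and is void with probability at most `exp
(-(k + 1))`. Against the weight `exp ((k + 1) / 2)` this leaves a geometric series. -/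
theorem lintegral_voidWeight_le [IsProbabilityMeasure P] (hd : 0 < d)
    (hlam : IsPoissonProcess P lam)
    (hQm : ∀ u, MeasurableSet (Q u)) (hQd : Pairwise (Function.onFun Disjoint Q))
    (hQtop : ∀ u, volume (Q u) ≠ ∞) (hQv : ∀ u, 1 ≤ volume.real (Q u)) (t : Fin d → Fin n) :
    ∫⁻ ω, voidWeight (lam ω) Q t ∂P ≤ 1 + (1 - ENNReal.ofReal (Real.exp (-(1 / 2))))⁻¹ := by
  have hmeas : ∀ k, Measurable fun ω =>
      ({0} : Set ℝ≥0∞).indicator (1 : ℝ≥0∞ → ℝ≥0∞) (∑ w ∈ gridBall t k, lam ω (Q w)) := fun k =>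
    (measurable_one.indicator (measurableSet_singleton 0)).comp
      (Finset.measurable_fun_sum _ fun w _ => hlam.measurable_apply (hQm w))
  have hvoid : ∀ k < n, ∫⁻ ω, ({0} : Set ℝ≥0∞).indicator (1 : ℝ≥0∞ → ℝ≥0∞)
      (∑ w ∈ gridBall t k, lam ω (Q w)) ∂P ≤ ENNReal.ofReal (Real.exp (-(k + 1))) := by
    intro k hk
    set A := ⋃ w ∈ gridBall t k, Q w with hA
    have hAm : MeasurableSet A := Finset.measurableSet_biUnion _ fun w _ => hQm w
    have hsum : ∀ ν : Measure (EuclideanSpace ℝ (Fin d)), ν A = ∑ w ∈ gridBall t k, ν (Q w) :=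
      fun ν => measure_biUnion_finset (fun u _ w _ huw => hQd huw) fun w _ => hQm w
    have hAtop : volume A ≠ ∞ := by
      rw [hsum]
      exact (ENNReal.sum_lt_top.2 fun w _ => (hQtop w).lt_top).ne
    have hAv : (k : ℝ) + 1 ≤ volume.real A := by
      rw [measureReal_def, hsum, ENNReal.toReal_sum fun w _ => hQtop w]
      calc (k : ℝ) + 1 ≤ (gridBall t k).card := by exact_mod_cast lt_card_gridBall hd t hk
        _ = ∑ _w ∈ gridBall t k, (1 : ℝ) := by simp
        _ ≤ _ := Finset.sum_le_sum fun w _ => hQv w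
    have hm : MeasurableSet {ω | lam ω A = 0} :=
      hlam.measurable_apply hAm (measurableSet_singleton 0)
    calc _ = ∫⁻ ω, {ω | lam ω A = 0}.indicator (1 : Ω → ℝ≥0∞) ω ∂P := by
          refine lintegral_congr fun ω => ?_
          rw [← hsum]
          simp [Set.indicator_apply]
      _ = ENNReal.ofReal (Real.exp (-volume.real A)) := by
          rw [lintegral_indicator_one hm, hlam.measure_eq_zero hAm hAtop]
      _ ≤ _ := by
          refine ENNReal.ofReal_le_ofReal (Real.exp_le_exp.2 ?_)
          linarith
  unfold voidWeight
  rw [lintegral_add_left measurable_const, lintegral_const, measure_univ, mul_one,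
    lintegral_finsetSum _ fun k _ => (hmeas k).const_mul _]
  gcongr
  calc _ ≤ ∑ k ∈ Finset.range n, ENNReal.ofReal (Real.exp (-(1 / 2))) ^ k := by
        refine Finset.sum_le_sum fun k hk => ?_
        rw [lintegral_const_mul _ (hmeas k), ← ENNReal.ofReal_pow (Real.exp_pos _).le,
          ← Real.exp_nat_mul]
        refine (mul_le_mul_right (hvoid k (Finset.mem_range.1 hk)) _).trans ?_
        rw [← ENNReal.ofReal_mul (Real.exp_pos _).le, ← Real.exp_add]
        refine ENNReal.ofReal_le_ofReal (Real.exp_le_exp.2 ?_)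
        linarith
    _ ≤ ∑' k : ℕ, ENNReal.ofReal (Real.exp (-(1 / 2))) ^ k := ENNReal.sum_le_tsum _
    _ = _ := ENNReal.tsum_geometric _

theorem lintegral_localWeight_le [IsProbabilityMeasure P] (hd : 0 < d)
    (hμ : IsPoissonProcess P μ) (hlam : IsPoissonProcess P lam)
    (hR : MeasurableSet R) (hRi : ∀ i, MeasurableSet (Ri i)) (hRv : 1 ≤ volume.real R)
    (hRiv : ∀ i, 1 ≤ volume.real (Ri i)) (hN : N ≤ 3 ^ d)
    (hQm : ∀ u, MeasurableSet (Q u)) (hQd : Pairwise (Function.onFun Disjoint Q))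
    (hQtop : ∀ u, volume (Q u) ≠ ∞) (hQv : ∀ u, 1 ≤ volume.real (Q u))
    (hQv' : ∀ u, volume.real (Q u) ≤ 8 ^ d) (u t : Fin d → Fin n) :
    ∫⁻ ω, localWeight (μ ω) (lam ω) R Ri Q u t ∂P ≤ weightConst d := by
  unfold localWeight
  have h1 := measurable_deviationWeight hμ hlam hR hRi
  have h2 := measurable_countWeight hlam (hQm u)
  rw [lintegral_add_left (h1.fun_add h2), lintegral_add_left h1]
  exact add_le_add (add_le_add (lintegral_deviationWeight_le hμ hlam hR hRi hRv hRiv hN)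
    (lintegral_countWeight_le hlam (hQm u) (hQtop u) (hQv' u)))
    (lintegral_voidWeight_le hd hlam hQm hQd hQtop hQv t)

/-- There are `n` hops, two weights per hop, and `n ^ (2 * d)` paths normalized by `n ^ d`. The
factor `n`, the length of the paths, is the loss that enters the final rate. -/
theorem lintegral_pathWeight_le [IsProbabilityMeasure P] (hd : 0 < d) (hn : 0 < n)
    (hμ : IsPoissonProcess P μ) (hlam : IsPoissonProcess P lam)
    (hR : MeasurableSet R) (hRi : ∀ i, MeasurableSet (Ri i)) (hRv : 1 ≤ volume.real R)
    (hRiv : ∀ i, 1 ≤ volume.real (Ri i)) (hN : N ≤ 3 ^ d)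
    (hQm : ∀ u, MeasurableSet (Q u)) (hQd : Pairwise (Function.onFun Disjoint Q))
    (hQtop : ∀ u, volume (Q u) ≠ ∞) (hQv : ∀ u, 1 ≤ volume.real (Q u))
    (hQv' : ∀ u, volume.real (Q u) ≤ 8 ^ d) :
    ∫⁻ ω, pathWeight (μ ω) (lam ω) R Ri Q ∂P ≤ (n : ℝ≥0∞) ^ d * (3 * n * weightConst d) := by
  have h0 : (n : ℝ≥0∞) ^ d ≠ 0 := pow_ne_zero _ (by exact_mod_cast hn.ne')
  have h1 : (n : ℝ≥0∞) ^ d ≠ ∞ := ENNReal.pow_ne_top (ENNReal.natCast_ne_top n)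
  have hloc := lintegral_localWeight_le hd hμ hlam hR hRi hRv hRiv hN hQm hQd hQtop hQv hQv'
  have hm := measurable_localWeight hμ hlam hR hRi hQm
  have hn1 : (1 : ℝ≥0∞) ≤ n := by exact_mod_cast hn
  have hz : ∀ k (z : (Fin d → Fin n) × (Fin d → Fin n)), Measurable fun ω =>
      localWeight (μ ω) (lam ω) R Ri Q z.1 (gridPath z.1 z.2 k) +
        localWeight (μ ω) (lam ω) R Ri Q z.1 (gridPath z.1 z.2 (k + 1)) :=
    fun k z => (hm _ _).fun_add (hm _ _)
  unfold pathWeight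
  rw [lintegral_add_left (Finset.measurable_fun_sum _ fun u _ => hm u u),
    lintegral_finsetSum _ fun u _ => hm u u, lintegral_const_mul _
    (Finset.measurable_fun_sum _ fun k _ => Finset.measurable_fun_sum _ fun z _ => hz k z),
    lintegral_finsetSum _ fun k _ => Finset.measurable_fun_sum _ fun z _ => hz k z]
  calc _ ≤ ∑ _u : Fin d → Fin n, weightConst d + ((n : ℝ≥0∞) ^ d)⁻¹ * ∑ _k ∈ Finset.range n,
        ∑ _z : (Fin d → Fin n) × (Fin d → Fin n), (weightConst d + weightConst d) := by
        refine add_le_add (Finset.sum_le_sum fun u _ => hloc u u)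
          (mul_le_mul_right (Finset.sum_le_sum fun k _ => ?_) _)
        rw [lintegral_finsetSum _ fun z _ => hz k z]
        refine Finset.sum_le_sum fun z _ => ?_
        rw [lintegral_add_left (hm _ _)]
        exact add_le_add (hloc _ _) (hloc _ _)
    _ = (n : ℝ≥0∞) ^ d * weightConst d
        + (((n : ℝ≥0∞) ^ d)⁻¹ * (n : ℝ≥0∞) ^ d) * ((n : ℝ≥0∞) ^ d * (2 * n * weightConst d)) := by
        simp only [Finset.sum_const, Finset.card_univ, Fintype.card_prod, Fintype.card_fun,
          Fintype.card_fin, Finset.card_range, nsmul_eq_mul, Nat.cast_mul, Nat.cast_pow]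
        ring
    _ = (n : ℝ≥0∞) ^ d * (1 * weightConst d + 2 * n * weightConst d) := by
        rw [ENNReal.inv_mul_cancel h0 h1]
        ring
    _ ≤ (n : ℝ≥0∞) ^ d * (n * weightConst d + 2 * n * weightConst d) := by gcongr
    _ = _ := by ring

theorem lintegral_totalWeight_le [IsProbabilityMeasure P] (hd : 0 < d) (hn : 0 < n)
    (hμ : IsPoissonProcess P μ) (hlam : IsPoissonProcess P lam)
    (hR : MeasurableSet R) (hRi : ∀ i, MeasurableSet (Ri i)) (hRv : 1 ≤ volume.real R)
    (hRiv : ∀ i, 1 ≤ volume.real (Ri i)) (hN : N ≤ 3 ^ d)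
    (hQm : ∀ u, MeasurableSet (Q u)) (hQd : Pairwise (Function.onFun Disjoint Q))
    (hQtop : ∀ u, volume (Q u) ≠ ∞) (hQv : ∀ u, 1 ≤ volume.real (Q u))
    (hQv' : ∀ u, volume.real (Q u) ≤ 8 ^ d) :
    ∫⁻ ω, totalWeight (μ ω) (lam ω) R Ri Q ∂P ≤ (n : ℝ≥0∞) ^ d * weightConst d := by
  -- The single deviation weight is bounded by its sum over cells, which needs at least one cell.
  have hne : Nonempty (Fin d → Fin n) := ⟨fun _ => ⟨0, hn⟩⟩
  have hle : ∀ ω, totalWeight (μ ω) (lam ω) R Ri Q ≤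
      ∑ u, localWeight (μ ω) (lam ω) R Ri Q u u := by
    intro ω
    simp only [totalWeight, localWeight, Finset.sum_add_distrib]
    gcongr
    exact Finset.single_le_sum
      (f := fun _ : Fin d → Fin n => deviationWeight (μ ω) (lam ω) R Ri)
      (fun _ _ => zero_le) (Finset.mem_univ (Classical.arbitrary _))
  refine (lintegral_mono hle).trans ?_
  rw [lintegral_finsetSum _ fun u _ => measurable_localWeight hμ hlam hR hRi hQm u u]
  refine (Finset.sum_le_sum fun u _ => lintegral_localWeight_le hd hμ hlam hR hRi hRv hRiv hN
    hQm hQd hQtop hQv hQv' u u).trans (le_of_eq ?_)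
  simp

end Expectation

/-! ### Integration of the pointwise bound and choice of parameters. -/

section Main

theorem lintegral_transportCostOn_le {d n N : ℕ} {p : ℝ} (hd : 0 < d) (hp : 0 < p) (hn : 3 ≤ n)
    {Ω : Type*} [MeasurableSpace Ω] {P : Measure Ω} [IsProbabilityMeasure P]
    {μ lam : Ω → Measure (EuclideanSpace ℝ (Fin d))} (hμ : IsPoissonProcess P μ)
    (hlam : IsPoissonProcess P lam) {R : Set (EuclideanSpace ℝ (Fin d))}
    {Ri : Fin N → Set (EuclideanSpace ℝ (Fin d))} {x : EuclideanSpace ℝ (Fin d)} {s : Fin d → ℝ}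
    (hs1 : ∀ i, 1 ≤ s i) (hs8 : ∀ i, s i ≤ 8) (hRs : R = rectangle x fun i => n * s i)
    (hpart : IsAdmissiblePartition R Ri) {T : ℕ} {σ : ℝ} (hσ : 0 < σ)
    (hσn : σ ^ 2 = ((3 : ℝ) ^ d)⁻¹ * (n : ℝ) ^ d)
    (hcap : 16 * (T / σ) * (1 + (2 * n + 1) * (T * 2 ^ d * (2 * T + 1) ^ d)) ≤ 1 / 2) :
    ∫⁻ ω in {ω | ∀ i, 0 < lam ω (Ri i)},
        (volume R)⁻¹ * transportCostOn p R
          (∑ i, massRatio (μ ω) (lam ω) (Ri i) • (lam ω).restrict (Ri i))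
          (massRatio (μ ω) (lam ω) R • lam ω) ∂P ≤
      ENNReal.ofReal (96 * (weightConst d).toReal * expConst p * (16 * d) ^ p * (n / σ) +
        3 * (weightConst d).toReal * ((d * (8 * n)) ^ p * Real.exp (-(T / 4)) * n ^ d)) := by
  have hn0 : 0 < n := by omega
  have hn1 : (1 : ℝ) ≤ n := by exact_mod_cast hn0
  have hs0 : ∀ i, 0 < s i := fun i => zero_lt_one.trans_le (hs1 i)
  have hU := hpart.iUnion_eq
  have hRm : MeasurableSet R := hRs ▸ measurableSet_rectangle x _
  have hRi := fun i => (hpart.moderate i).measurableSet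
  have hsub : ∀ i, Ri i ⊆ R := fun i => hU ▸ subset_iUnion Ri i
  have hVn : (n : ℝ) ^ d ≤ volume.real R := hRs ▸ pow_le_volume_rectangle hs1
  have hV1 : 1 ≤ volume.real R := (one_le_pow₀ hn1).trans hVn
  have hVtop : volume R ≠ ∞ := hRs ▸ volume_rectangle_ne_top x _
  -- The pieces have volume at least `(n / 3) ^ d`, which is where `3 ≤ n` enters.
  have hV3 : ∀ i, 1 ≤ volume.real (Ri i) := fun i => by
    refine le_trans ?_ (hpart.le_volume i)
    rw [← div_eq_inv_mul, one_le_div (by positivity)]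
    refine le_trans ?_ hVn
    gcongr
    exact_mod_cast hn
  set Q : (Fin d → Fin n) → Set (EuclideanSpace ℝ (Fin d)) := fun u => gridCell x s u with hQdef
  have hQm : ∀ u, MeasurableSet (Q u) := measurableSet_gridCell
  have hQd : Pairwise (Function.onFun Disjoint Q) := pairwise_disjoint_gridCell hs0
  have hQtop : ∀ u, volume (Q u) ≠ ∞ := fun u => by
    rw [hQdef, volume_gridCell]
    exact ENNReal.prod_ne_top fun i _ => ENNReal.ofReal_ne_top
  have hQreal : ∀ u, volume.real (Q u) = ∏ i, s i := fun u => by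
    rw [hQdef, measureReal_def, volume_gridCell, ENNReal.toReal_prod]
    exact Finset.prod_congr rfl fun i _ => ENNReal.toReal_ofReal (hs0 i).le
  have hQv : ∀ u, 1 ≤ volume.real (Q u) := fun u => by
    rw [hQreal]
    exact Finset.one_le_prod fun i _ => hs1 i
  have hQv' : ∀ u, volume.real (Q u) ≤ 8 ^ d := fun u => by
    rw [hQreal]
    calc ∏ i, s i ≤ ∏ _i : Fin d, (8 : ℝ) :=
          Finset.prod_le_prod (fun i _ => (hs0 i).le) fun i _ => hs8 i
      _ = 8 ^ d := by simp
  have hNle := hpart.card_le (zero_lt_one.trans_le hV1)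
  have hpath := lintegral_pathWeight_le hd hn0 hμ hlam hRm hRi hV1 hV3 hNle hQm hQd hQtop hQv hQv'
  have htot := lintegral_totalWeight_le hd hn0 hμ hlam hRm hRi hV1 hV3 hNle hQm hQd hQtop hQv hQv'
  have hpathm := measurable_pathWeight hμ hlam hRm hRi hQm
  have htotm := measurable_totalWeight hμ hlam hRm hRi hQm
  have hnull : ∀ ν : Ω → Measure (EuclideanSpace ℝ (Fin d)), IsPoissonProcess P ν →
      ∀ᵐ ω ∂P, ∀ i j, i ≠ j → ν ω (Ri i ∩ Ri j) = 0 := by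
    intro ν hν
    rw [ae_all_iff]; intro i
    rw [ae_all_iff]; intro j
    by_cases hij : i = j
    · exact Filter.Eventually.of_forall fun _ h => absurd hij h
    · filter_upwards [hν.ae_eq_zero ((hRi i).inter (hRi j)) (hpart.null_inter i j hij)]
        with ω hω _ using hω
  have hQnull : ∀ᵐ ω ∂P, lam ω (R \ ⋃ u, Q u) = 0 :=
    hlam.ae_eq_zero (hRm.diff (MeasurableSet.iUnion hQm))
      (by rw [hRs]; exact volume_rectangle_diff_gridCell hs0)
  have hEm : MeasurableSet {ω | ∀ i, 0 < lam ω (Ri i)} := by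
    have : {ω | ∀ i, 0 < lam ω (Ri i)} = ⋂ i, {ω | 0 < lam ω (Ri i)} := by ext; simp
    rw [this]
    exact MeasurableSet.iInter fun i =>
      measurableSet_lt measurable_const (hlam.measurable_apply (hRi i))
  set A : ℝ≥0∞ := ((n : ℝ≥0∞) ^ d)⁻¹ * (2 * ENNReal.ofReal (16 / σ) *
    (2 * ENNReal.ofReal (d * 8)) ^ p * ENNReal.ofReal (expConst p)) with hA
  set B : ℝ≥0∞ := ENNReal.ofReal (d * (8 * n)) ^ p * (ENNReal.ofReal (Real.exp (-(T / 4))) * 3)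
    with hB
  have hec : 0 ≤ expConst p := by unfold expConst; positivity
  have hK : ENNReal.ofReal (weightConst d).toReal = weightConst d :=
    ENNReal.ofReal_toReal (weightConst_ne_top d)
  have h0 : (n : ℝ≥0∞) ^ d ≠ 0 := pow_ne_zero _ (by exact_mod_cast hn0.ne')
  have h1 : (n : ℝ≥0∞) ^ d ≠ ∞ := ENNReal.pow_ne_top (ENNReal.natCast_ne_top n)
  calc _ ≤ ∫⁻ ω in {ω | ∀ i, 0 < lam ω (Ri i)}, (A * pathWeight (μ ω) (lam ω) R Ri Q +
        B * totalWeight (μ ω) (lam ω) R Ri Q) ∂P := by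
        refine lintegral_mono_ae ?_
        rw [ae_restrict_iff' hEm]
        filter_upwards [hnull μ hμ, hnull lam hlam, hμ.ae_lt_top hRm hVtop,
          hlam.ae_lt_top hRm hVtop, hQnull] with ω hmn hln hm hl hQ hpos
        refine (inv_volume_mul_transportCostOn_le hp hn0 hs1 hs8 hRs hpart hmn hln hm.ne hl.ne hpos
          hQ (fun u hu => hlam.one_le_of_pos (hQm u) hu) hσ hσn hcap).trans (le_of_eq ?_)
        rw [hA, hB]
        simp only [mul_assoc]
        rfl
    _ ≤ ∫⁻ ω, (A * pathWeight (μ ω) (lam ω) R Ri Q +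
        B * totalWeight (μ ω) (lam ω) R Ri Q) ∂P := setLIntegral_le_lintegral _ _
    _ ≤ A * ((n : ℝ≥0∞) ^ d * (3 * n * weightConst d)) +
        B * ((n : ℝ≥0∞) ^ d * weightConst d) := by
        rw [lintegral_add_left (hpathm.const_mul A), lintegral_const_mul _ hpathm,
          lintegral_const_mul _ htotm]
        gcongr
    _ = (((n : ℝ≥0∞) ^ d)⁻¹ * (n : ℝ≥0∞) ^ d) * (2 * ENNReal.ofReal (16 / σ) *
        (2 * ENNReal.ofReal (d * 8)) ^ p * ENNReal.ofReal (expConst p) *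
          (3 * n * weightConst d)) + B * ((n : ℝ≥0∞) ^ d * weightConst d) := by
        rw [hA]; ring
    _ = ENNReal.ofReal (2 * (16 / σ) * (2 * (d * 8)) ^ p * expConst p *
          (3 * n * (weightConst d).toReal)) +
        ENNReal.ofReal ((d * (8 * n)) ^ p * (Real.exp (-(T / 4)) * 3) *
          (n ^ d * (weightConst d).toReal)) := by
        have e1 : (2 * ENNReal.ofReal (d * 8)) ^ p = ENNReal.ofReal ((2 * (d * 8)) ^ p) := by
          rw [← ENNReal.ofReal_rpow_of_nonneg (by positivity) hp.le,
            ENNReal.ofReal_mul (p := 2) (by norm_num), ENNReal.ofReal_ofNat]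
        have hX : (0 : ℝ) ≤ (2 * (d * 8)) ^ p := by positivity
        have hY : (0 : ℝ) ≤ (d * (8 * n)) ^ p := by positivity
        rw [ENNReal.inv_mul_cancel h0 h1, one_mul, hB, e1,
          ENNReal.ofReal_rpow_of_nonneg (by positivity) hp.le]
        generalize ((2 * (d * 8) : ℝ)) ^ p = X at hX
        generalize ((d * (8 * n) : ℝ)) ^ p = Y at hY
        repeat rw [ENNReal.ofReal_mul (by positivity)]
        rw [hK, ENNReal.ofReal_pow (by positivity), ENNReal.ofReal_natCast,
          ENNReal.ofReal_ofNat, ENNReal.ofReal_ofNat]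
    _ = _ := by
        rw [← ENNReal.ofReal_add (by positivity) (by positivity)]
        congr 1
        rw [show (2 * (d * 8) : ℝ) = 16 * d by ring]
        ring

open Filter Topology in
/-- The polynomially small radius `T = ⌈n ^ ε⌉` makes the exceptional event negligible, and keeps
the transported mass below the available mass. -/
theorem eventually_radius_bounds {d : ℕ} (hd : 3 ≤ d) (p : ℝ) :
    ∃ T : ℕ → ℕ, ∀ᶠ n : ℕ in atTop,
      16 * (T n / ((n : ℝ) ^ ((d : ℝ) / 2) / 3 ^ ((d : ℝ) / 2))) *
        (1 + (2 * n + 1) * (T n * 2 ^ d * (2 * T n + 1) ^ d)) ≤ 1 / 2 ∧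
      (d * (8 * n)) ^ p * Real.exp (-(T n / 4)) * n ^ d ≤ (n : ℝ) ^ (1 - (d : ℝ) / 2) := by
  have hd' : (3 : ℝ) ≤ d := by exact_mod_cast hd
  -- The capacity condition has degree `d + 2` in `T`, so its powers of `T` contribute `n ^ (1 /
  -- 4)`. The total exponent `1 + 1 / 4 - d / 2` is at most `-1 / 4` for `d ≥ 3`.
  set ε : ℝ := 1 / (4 * (d + 2)) with hε
  have hε0 : 0 < ε := by positivity
  have hlim : Tendsto (fun n : ℕ => (n : ℝ)) atTop atTop := tendsto_natCast_atTop_atTop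
  refine ⟨fun n => ⌈(n : ℝ) ^ ε⌉₊, ?_⟩
  set C : ℝ := 16 * (2 * 3 ^ ((d : ℝ) / 2)) * (1 + 3 * (2 * 2 ^ d * 5 ^ d)) with hC
  have hC0 : 0 < C := by positivity
  -- This is the power of `n` which the exponential has to beat: `p + d` from diameter and mass, and
  -- `d / 2 - 1` from the target rate.
  set a : ℝ := p + d + (d / 2 - 1) with ha
  have e1 : ∀ᶠ n : ℕ in atTop, (n : ℝ) ^ (-(1 / 4) : ℝ) < 1 / (2 * C) :=
    ((tendsto_rpow_neg_atTop (by norm_num : (0 : ℝ) < 1 / 4)).comp hlim).eventually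
      (gt_mem_nhds (by positivity))
  have hc : 0 < (8 * (d : ℝ)) ^ p := by positivity
  have e2 : ∀ᶠ n : ℕ in atTop, ((n : ℝ) ^ ε) ^ (a / ε) * Real.exp (-(1 / 4) * (n : ℝ) ^ ε)
      < 1 / (8 * (d : ℝ)) ^ p :=
    ((tendsto_rpow_mul_exp_neg_mul_atTop_nhds_zero (a / ε) (1 / 4) (by norm_num)).comp
      ((tendsto_rpow_atTop hε0).comp hlim)).eventually (gt_mem_nhds (by positivity))
  filter_upwards [e1, e2, eventually_ge_atTop 1] with n h1 h2 hn
  have hn1 : (1 : ℝ) ≤ n := by exact_mod_cast hn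
  have hn0 : (0 : ℝ) < n := by linarith
  set y : ℝ := (n : ℝ) ^ ε with hy
  have hy1 : 1 ≤ y := Real.one_le_rpow hn1 hε0.le
  have hTy : y ≤ (⌈y⌉₊ : ℝ) := Nat.le_ceil y
  have hTy2 : (⌈y⌉₊ : ℝ) ≤ 2 * y := by
    have := Nat.ceil_lt_add_one (by linarith : 0 ≤ y)
    linarith
  set T : ℝ := (⌈y⌉₊ : ℝ) with hT
  have hT0 : 0 ≤ T := by linarith
  constructor
  · have hb1 : 1 + (2 * (n : ℝ) + 1) * (T * 2 ^ d * (2 * T + 1) ^ d)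
        ≤ (1 + 3 * (2 * 2 ^ d * 5 ^ d)) * (n * y ^ (d + 1)) := by
      have h3 : (2 * T + 1) ^ d ≤ (5 * y) ^ d := by
        gcongr
        linarith
      have h4 : (2 * (n : ℝ) + 1) * (T * 2 ^ d * (2 * T + 1) ^ d)
          ≤ (3 * n) * (2 * y * 2 ^ d * (5 * y) ^ d) := by
        gcongr
        linarith
      have h5 : 1 ≤ n * y ^ (d + 1) := one_le_mul_of_one_le_of_one_le hn1 (one_le_pow₀ hy1)
      calc _ ≤ n * y ^ (d + 1) + (3 * n) * (2 * y * 2 ^ d * (5 * y) ^ d) := add_le_add h5 h4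
        _ = _ := by rw [mul_pow, pow_succ]; ring
    have hyd : y ^ (d + 1) * y = (n : ℝ) ^ (1 / 4 : ℝ) := by
      rw [← pow_succ, hy, ← Real.rpow_natCast, ← Real.rpow_mul hn0.le, hε]
      congr 1
      push_cast
      field_simp
      ring
    calc 16 * (T / ((n : ℝ) ^ ((d : ℝ) / 2) / 3 ^ ((d : ℝ) / 2))) *
          (1 + (2 * n + 1) * (T * 2 ^ d * (2 * T + 1) ^ d))
        ≤ 16 * ((2 * y) / ((n : ℝ) ^ ((d : ℝ) / 2) / 3 ^ ((d : ℝ) / 2))) *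
          ((1 + 3 * (2 * 2 ^ d * 5 ^ d)) * (n * y ^ (d + 1))) := by gcongr
      _ = C * (n * (y ^ (d + 1) * y) * ((n : ℝ) ^ ((d : ℝ) / 2))⁻¹) := by
          rw [hC]
          have : (0 : ℝ) < 3 ^ ((d : ℝ) / 2) := by positivity
          have : 0 < (n : ℝ) ^ ((d : ℝ) / 2) := by positivity
          field_simp
      _ = C * (n : ℝ) ^ (1 + 1 / 4 + -((d : ℝ) / 2)) := by
          rw [hyd, Real.rpow_add hn0, Real.rpow_add hn0, Real.rpow_one, Real.rpow_neg hn0.le]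
      _ ≤ C * (n : ℝ) ^ (-(1 / 4) : ℝ) := by
          gcongr
          linarith
      _ ≤ C * (1 / (2 * C)) := by gcongr
      _ = 1 / 2 := by field_simp
  · have h3 : Real.exp (-(T / 4)) ≤ Real.exp (-(1 / 4) * y) := Real.exp_le_exp.2 (by linarith)
    have h4 : y ^ (a / ε) = (n : ℝ) ^ a := by
      rw [hy, ← Real.rpow_mul hn0.le, mul_div_cancel₀ _ hε0.ne']
    rw [h4, lt_div_iff₀ hc] at h2
    have h5 : (n : ℝ) ^ a = (n : ℝ) ^ p * n ^ d * (n : ℝ) ^ ((d : ℝ) / 2 - 1) := by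
      rw [ha, Real.rpow_add hn0, Real.rpow_add hn0, Real.rpow_natCast]
    have h6 : (n : ℝ) ^ ((d : ℝ) / 2 - 1) * (n : ℝ) ^ (1 - (d : ℝ) / 2) = 1 := by
      rw [← Real.rpow_add hn0]
      simp
    have h7 : 0 < (n : ℝ) ^ (1 - (d : ℝ) / 2) := by positivity
    calc (d * (8 * n)) ^ p * Real.exp (-(T / 4)) * (n : ℝ) ^ d
        ≤ (d * (8 * n)) ^ p * Real.exp (-(1 / 4) * y) * (n : ℝ) ^ d := by gcongr
      _ = (8 * d) ^ p * (n : ℝ) ^ p * Real.exp (-(1 / 4) * y) * (n : ℝ) ^ d *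
          ((n : ℝ) ^ ((d : ℝ) / 2 - 1) * (n : ℝ) ^ (1 - (d : ℝ) / 2)) := by
          rw [h6, show (d * (8 * n) : ℝ) = (8 * d) * n by ring,
            Real.mul_rpow (by positivity) hn0.le, mul_one]
      _ = ((n : ℝ) ^ a * Real.exp (-(1 / 4) * y) * (8 * d) ^ p) *
          (n : ℝ) ^ (1 - (d : ℝ) / 2) := by rw [h5]; ring
      _ ≤ 1 * (n : ℝ) ^ (1 - (d : ℝ) / 2) := by gcongr
      _ = _ := one_mul _

theorem rpow_mesh_le_rpow_volume {d n : ℕ} (hd : 3 ≤ d) (hn : 0 < n) {V : ℝ} (hV : 0 < V)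
    (hV' : V ≤ (8 * n : ℝ) ^ d) :
    (n : ℝ) ^ (1 - (d : ℝ) / 2) ≤
      8 ^ (((d : ℝ) - 2) / 2) * V ^ (-(((d : ℝ) - 2) / (2 * d))) := by
  have hd' : (3 : ℝ) ≤ d := by exact_mod_cast hd
  have hn0 : (0 : ℝ) < n := by exact_mod_cast hn
  have h1 : ((8 * n : ℝ) ^ d) ^ (-(((d : ℝ) - 2) / (2 * d)))
      ≤ V ^ (-(((d : ℝ) - 2) / (2 * d))) :=
    Real.rpow_le_rpow_of_nonpos hV hV' (by
      rw [neg_nonpos]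
      exact div_nonneg (by linarith) (by linarith))
  have h2 : ((8 * n : ℝ) ^ d) ^ (-(((d : ℝ) - 2) / (2 * d)))
      = 8 ^ (-(((d : ℝ) - 2) / 2)) * (n : ℝ) ^ (1 - (d : ℝ) / 2) := by
    rw [← Real.rpow_natCast, ← Real.rpow_mul (by positivity),
      show (d : ℝ) * -(((d : ℝ) - 2) / (2 * d)) = -(((d : ℝ) - 2) / 2) by field_simp,
      Real.mul_rpow (by norm_num) hn0.le]
    congr 2
    ring
  calc (n : ℝ) ^ (1 - (d : ℝ) / 2)
      = 8 ^ (((d : ℝ) - 2) / 2) * (8 ^ (-(((d : ℝ) - 2) / 2)) * (n : ℝ) ^ (1 - (d : ℝ) / 2)) := by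
        rw [← mul_assoc, ← Real.rpow_add (by norm_num)]
        simp
    _ ≤ _ := by
        rw [← h2]
        gcongr

theorem mainTheorem6 (d : ℕ) (hd : 3 ≤ d) (p : ℝ) (hp : 1 ≤ p) :
    ∃ M C : ℝ, 0 < M ∧ 0 < C ∧
      ∀ (Ω : Type*) [MeasurableSpace Ω] (P : Measure Ω) [IsProbabilityMeasure P]
        (μ lam : Ω → Measure (EuclideanSpace ℝ (Fin d))),
        IsPoissonProcess P μ → IsPoissonProcess P lam → IndepFun μ lam P →
        ∀ (R : Set (EuclideanSpace ℝ (Fin d))), IsModerateRectangle R → M ≤ volume.real R →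
        ∀ (N : ℕ) (Ri : Fin N → Set (EuclideanSpace ℝ (Fin d))), IsAdmissiblePartition R Ri →
          ∫⁻ ω in {ω | ∀ i, 0 < lam ω (Ri i)},
              (volume R)⁻¹ * transportCostOn p R
                (∑ i, massRatio (μ ω) (lam ω) (Ri i) • (lam ω).restrict (Ri i))
                (massRatio (μ ω) (lam ω) R • lam ω) ∂P
            ≤ ENNReal.ofReal (C * volume.real R ^ (-(((d : ℝ) - 2) / (2 * d)))) := by
  have hp0 : 0 < p := by linarith
  have hd0 : 0 < d := by omega
  obtain ⟨T, hT⟩ := eventually_radius_bounds hd p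
  obtain ⟨n₁, hn₁⟩ := Filter.eventually_atTop.1 hT
  set n₀ := max n₁ 3 with hn₀
  set k := (weightConst d).toReal with hk
  have hk0 : 0 ≤ k := ENNReal.toReal_nonneg
  have hec : 0 ≤ expConst p := by unfold expConst; positivity
  -- The first summand comes from the good event, `3 * k` from the exceptional one, and the final 1
  -- makes the constant positive.
  set C₁ : ℝ := 96 * k * expConst p * (16 * d) ^ p * 3 ^ ((d : ℝ) / 2) + 3 * k + 1 with hC₁
  have hC₁0 : 0 < C₁ := by positivity
  have hn₀0 : 0 < n₀ := by omega
  -- This volume threshold lets `IsModerateRectangle.exists_mesh` provide `n ≥ n₀`; the power of 8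
  -- converts `n` back into `|R|`.
  refine ⟨(4 * n₀ : ℝ) ^ d, C₁ * 8 ^ (((d : ℝ) - 2) / 2), by positivity, by positivity, ?_⟩
  intro Ω _ P _ μ lam hμ hlam _ R hR hM N Ri hpart
  obtain ⟨x, s, n, hn, hs1, hs8, hRs⟩ := hR.exists_mesh hd0 hn₀0 hM
  have hn3 : 3 ≤ n := (le_max_right _ _).trans hn
  have hn0 : (0 : ℝ) < n := by exact_mod_cast (by omega : 0 < n)
  obtain ⟨hcap, hexp⟩ := hn₁ n ((le_max_left _ _).trans hn)
  -- This is `(n / 3) ^ (d / 2)`, a lower bound for the standard deviation of the count in every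
  -- piece.
  set σ : ℝ := (n : ℝ) ^ ((d : ℝ) / 2) / 3 ^ ((d : ℝ) / 2) with hσ
  have hσ0 : 0 < σ := by positivity
  have hσn : σ ^ 2 = ((3 : ℝ) ^ d)⁻¹ * (n : ℝ) ^ d := by
    have h : ∀ b : ℝ, 0 < b → (b ^ ((d : ℝ) / 2)) ^ 2 = b ^ d := by
      intro b hb
      rw [← Real.rpow_natCast, ← Real.rpow_mul hb.le, ← Real.rpow_natCast b d]
      congr 1
      push_cast
      ring
    rw [hσ, div_pow, h _ hn0, h 3 (by norm_num), div_eq_inv_mul]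
  refine (lintegral_transportCostOn_le hd0 hp0 hn3 hμ hlam hs1 hs8 hRs hpart hσ0 hσn hcap).trans
    (ENNReal.ofReal_le_ofReal ?_)
  have hnσ : n / σ = 3 ^ ((d : ℝ) / 2) * (n : ℝ) ^ (1 - (d : ℝ) / 2) := by
    rw [hσ, Real.rpow_sub hn0, Real.rpow_one]
    field_simp
  have hV : 0 < volume.real R := lt_of_lt_of_le (by positivity) hM
  have hV' : volume.real R ≤ (8 * n : ℝ) ^ d := hRs ▸ volume_rectangle_le_pow hs1 hs8
  have hy : 0 < (n : ℝ) ^ (1 - (d : ℝ) / 2) := by positivity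
  calc _ ≤ 96 * k * expConst p * (16 * d) ^ p * (3 ^ ((d : ℝ) / 2) * (n : ℝ) ^ (1 - (d : ℝ) / 2)) +
        3 * k * (n : ℝ) ^ (1 - (d : ℝ) / 2) := by
        rw [hnσ]
        gcongr
    _ ≤ C₁ * (n : ℝ) ^ (1 - (d : ℝ) / 2) := by
        rw [hC₁]
        nlinarith
    _ ≤ C₁ * (8 ^ (((d : ℝ) - 2) / 2) * volume.real R ^ (-(((d : ℝ) - 2) / (2 * d)))) := by
        gcongr
        exact rpow_mesh_le_rpow_volume hd (by omega) hV hV'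
    _ = _ := by ring

end Main
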